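/- Let $R$ be a right Noetherian ring and let $A=\sigma(R)\langle x_1,\dots,x_n\rangle$ be a bijective skew PBW extension of $R$. This means: $R\subseteq A$ is a subring; $A$ is a free left $R$-module with basis $\{x^\alpha=x_1^{\alpha_1}\cdots x_n^{\alpha_n}\mid\alpha\in\mathbb N^n\}$; for all $i$ and $0\ne r\in R$ there is $c_{i,r}\in R\setminus\{0\}$ with $x_ir-c_{i,r}x_i\in R$; for all $i,j$ there is $c_{i,j}\in R\setminus\{0\}$ with $x_jx_i-c_{i,j}x_ix_j\in R+Rx_1+\cdots+Rx_n$; the maps $\sigma_i:R\to R$ given by $x_ir-\sigma_i(r)x_i\in R$ are bijective, and the $c_{i,j}$ are invertible. Put $\sigma^\alpha=\sigma_1^{\alpha_1}\cdots\sigma_n^{\alpha_n}$, $\psi_{\beta,\gamma}=\sigma^{\beta+\gamma}(\sigma^{\gamma})^{-1}$, and let $c_{\alpha,\beta}\in R$ be the coefficient of $x^{\alpha+\beta}$ in $x^\alpha x^\beta$. Fix a monomial order on $\mathrm{Mon}(A)=\{x^\alpha\}$, that is, a total order $\preceq$ such that $x^\alpha\preceq x^\beta$ implies $\mathrm{lm}(x^\gamma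 x^\alpha x^\lambda)\preceq\mathrm{lm}(x^\gamma x^\beta x^\lambda)$, $1\preceq x^\alpha$, and $|\alpha|<|\beta|$ implies $x^\alpha\prec x^\beta$. Fix also a monomial order on $\mathrm{Mon}(A^m)=\{x^\alpha e_i\}$, that is, a total order $\preceq$ such that $x^\alpha e_i\preceq\mathrm{lm}(x^\beta x^\alpha)e_i$; $x^\alpha e_i\preceq x^\beta e_j$ implies $\mathrm{lm}(x^\gamma x^\alpha)e_i\preceq\mathrm{lm}(x^\gamma x^\beta)e_j$; and $|\alpha|<|\beta|$ implies $x^\alpha e_i\prec x^\beta e_j$. For $0\neq f\in A^m$ let $\mathrm{lm}(f)$ be the greatest monomial occurring in $f$, $\mathrm{lc}(f)\in R$ its (left) coefficient, and $\exp(\mathrm{lm}(f))$ and $\mathrm{ind}(\mathrm{lm}(f))$ the exponent $\alpha$ and the index $i$ of $\mathrm{lm}(f)=x^\alpha e_i$. *Reduction.* For a finite set $F$ of nonzero vectors and $f\ne0$, $f$ reduces to $h$ in one step by $F$ if there are $f_1,\dots,f_t\in F$, $r_1,\dots,r_t\in R$, $\alpha_1,\dots,\alpha_t\in\mathbb N^n$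 such that, with $\beta_i=\exp(\mathrm{lm}(f_i))$: $\mathrm{ind}(\mathrm{lm}(f_i))=\mathrm{ind}(\mathrm{lm}(f))$, $\beta_i+\alpha_i=\exp(\mathrm{lm}(f))$, $\mathrm{lc}(f)=\sum_i\mathrm{lc}(f_i)\sigma^{\beta_i}(r_i)c_{\beta_i,\alpha_i}$ and $h=f-\sum_if_ir_ix^{\alpha_i}$. The vector $f$ is reduced with respect to $F$ if $f=0$ or no one-step reduction of $f$ by $F$ exists. A Gröbner basis of a right submodule $M\neq0$ of $A^m$ is a nonempty finite set $G$ of nonzero vectors of $M$ such that no nonzero element of $M$ is reduced with respect to $G$; the Gröbner basis of $0$ is $\{0\}$. *Syzygies.* For a finite nonempty set $S$ of nonzero vectors of $A^m$ whose leading monomials have the same index $i$, let $X_S=x^{\varepsilon}e_i$ be the least common multiple of these monomials ($\varepsilon$ is the componentwise maximum of the exponents); if the indices differ, put $X_S=0$. If $X_S\ne0$, put $\beta_g=\exp(\mathrm{lm}(g))$ and $\gamma_g=\varepsilon-\beta_g$ for $g\in S$. A set $B_S$ is a finite set of generators of the right $R$-module $\{(b_g)\in R^S\mid\sum_{g\in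 S}\mathrm{lc}(g)c_{\beta_g,\gamma_g}b_g=0\}$. *Right Buchberger algorithm.* Input: a finite set $F$. Start with $G:=\emptyset$, $G':=F$. While $G'\ne G$: put $D:=P(G')\setminus P(G)$ (sets of subsets) and $G:=G'$; for each $S\in D$ with $X_S\neq0$, compute some $B_S$, and for each $b\in B_S$ reduce the S-vector $\sum_{g\in S}g\,\psi_{\beta_g,\gamma_g}^{-1}(b_g)x^{\gamma_g}$ by successive one-step reductions by the current $G'$ to a vector $r$ that is reduced with respect to $G'$; if $r\ne0$, replace $G'$ by $G'\cup\{r\}$. Output: $G$. **Theorem.** Let $F=\{f_1,\dots,f_s\}$, $s\geq1$, be a finite nonempty set of nonzero vectors of $A^m$. Whatever choices are made during the execution (order of the $S$ and the $b$, generating sets $B_S$, single reductions), the right Buchberger algorithm with input $F$ can always be continued until it gives an output, it terminates after finitely many steps (these include the single reductions), and its output is a Gröbner basis of the right submodule $\langle F\rangle$ of $A^m$. -/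

import Mathlib

namespace SkewPBW

/-- The standard monomial `x^α = x_1^{α_1} ⋯ x_n^{α_n}` (factors in this order). -/
def mon {A : Type*} [Ring A] {n : ℕ} (x : Fin n → A) (α : Fin n → ℕ) : A :=
  (List.ofFn fun i => x i ^ α i).prod

/-- The total degree `|α|`. -/
def deg {n : ℕ} (α : Fin n → ℕ) : ℕ := ∑ i, α i

/-- A skew PBW extension `A = σ(R)⟨x_1, …, x_n⟩` of `R`; the inclusion `R ⊆ A` is `ι`. -/
structure SkewPBWExt (R A : Type*) [Ring R] [Ring A] (n : ℕ) where
  ι : R →+* A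
  ι_injective : Function.Injective ι
  x : Fin n → A
  /-- `A` is a free left `R`-module whose basis is the family of standard monomials: every element
  of `A` is `∑ r_α x^α` for exactly one finitely supported family `(r_α)`. -/
  basis : Function.Bijective
    fun r : (Fin n → ℕ) →₀ R => r.sum fun α a => ι a * mon x α
  exists_coeff : ∀ (i : Fin n) (r : R), r ≠ 0 →
    ∃ c : R, c ≠ 0 ∧ ∃ d : R, x i * ι r - ι c * x i = ι d
  exists_comm : ∀ i j : Fin n, ∃ c : R, c ≠ 0 ∧ ∃ (d₀ : R) (d : Fin n → R),
    x j * x i - ι c * (x i * x j) = ι d₀ + ∑ k, ι (d k) * x k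

namespace SkewPBWExt

variable {R A : Type*} [Ring R] [Ring A] {n : ℕ}

/-- The coefficients of `a : A` in the left basis of standard monomials. -/
noncomputable def coeff (P : SkewPBWExt R A n) (a : A) : (Fin n → ℕ) →₀ R :=
  (Equiv.ofBijective _ P.basis).symm a

/-- `σ_i : R → R`: the coefficient of `x_i` in `x_i r = σ_i(r) x_i + δ_i(r)`. -/
noncomputable def sigma (P : SkewPBWExt R A n) (i : Fin n) (r : R) : R :=
  P.coeff (P.x i * P.ι r) (Pi.single i 1)

/-- `c_{α,β}`: the coefficient of `x^{α+β}` in `x^α x^β`. -/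
noncomputable def c (P : SkewPBWExt R A n) (α β : Fin n → ℕ) : R :=
  P.coeff (mon P.x α * mon P.x β) (α + β)

end SkewPBWExt

/-- A bijective skew PBW extension: the `σ_i` are bijective and the `c_{i,j}` are invertible. -/
structure BijSkewPBWExt (R A : Type*) [Ring R] [Ring A] (n : ℕ) extends SkewPBWExt R A n where
  sigma_bijective : ∀ i, Function.Bijective (toSkewPBWExt.sigma i)
  exists_unit_comm : ∀ i j : Fin n, ∃ (c : Rˣ) (d₀ : R) (d : Fin n → R),
    x j * x i - ι c * (x i * x j) = ι d₀ + ∑ k, ι (d k) * x k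

namespace BijSkewPBWExt

variable {R A : Type*} [Ring R] [Ring A] {n : ℕ}

/-- `σ^α = σ_1^{α_1} ⋯ σ_n^{α_n}`, as a permutation of `R` (multiplication is composition). -/
noncomputable def sigmaPow (P : BijSkewPBWExt R A n) (α : Fin n → ℕ) : Equiv.Perm R :=
  (List.ofFn fun i => (Equiv.ofBijective _ (P.sigma_bijective i) : Equiv.Perm R) ^ α i).prod

/-- `ψ_{θ₁,θ₂}(r) = σ^{θ₁+θ₂}(σ^{-θ₂}(r))`. -/
noncomputable def psi (P : BijSkewPBWExt R A n) (θ₁ θ₂ : Fin n → ℕ) : Equiv.Perm R :=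
  P.sigmaPow (θ₁ + θ₂) * (P.sigmaPow θ₂)⁻¹

/-- `lm(a) = x^μ` with respect to the relation `le` on exponents (in particular `a ≠ 0`). -/
def IsLM (P : BijSkewPBWExt R A n) (le : (Fin n → ℕ) → (Fin n → ℕ) → Prop)
    (a : A) (μ : Fin n → ℕ) : Prop :=
  P.coeff a μ ≠ 0 ∧ ∀ ν, P.coeff a ν ≠ 0 → le ν μ

end BijSkewPBWExt

/-- A monomial order on `Mon(A)`; the monomial `x^α` is represented by `α`, and
`le α β` stands for `x^α ⪯ x^β`. -/
structure MonOrder {R A : Type*} [Ring R] [Ring A] {n : ℕ} (P : BijSkewPBWExt R A n) where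
  le : (Fin n → ℕ) → (Fin n → ℕ) → Prop
  refl : ∀ α, le α α
  antisymm : ∀ α β, le α β → le β α → α = β
  trans : ∀ α β γ, le α β → le β γ → le α γ
  total : ∀ α β, le α β ∨ le β α
  mul_mono : ∀ α β γ l μ ν, le α β →
    P.IsLM le (mon P.x γ * mon P.x β * mon P.x l) μ →
    P.IsLM le (mon P.x γ * mon P.x α * mon P.x l) ν → le ν μ
  one_le : ∀ α, le 0 α
  deg_compat : ∀ α β, deg α < deg β → le α β

/-- A monomial order on `Mon(A^m)`; the monomial `x^α e_i` is represented by `(i, α)`, and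
`le X Y` stands for `X ⪯ Y`. -/
structure VecMonOrder {R A : Type*} [Ring R] [Ring A] {n : ℕ} (P : BijSkewPBWExt R A n)
    (O : MonOrder P) (m : ℕ) where
  le : Fin m × (Fin n → ℕ) → Fin m × (Fin n → ℕ) → Prop
  refl : ∀ X, le X X
  antisymm : ∀ X Y, le X Y → le Y X → X = Y
  trans : ∀ X Y Z, le X Y → le Y Z → le X Z
  total : ∀ X Y, le X Y ∨ le Y X
  le_mul : ∀ i α β μ, P.IsLM O.le (mon P.x β * mon P.x α) μ → le (i, α) (i, μ)
  mul_mono : ∀ i j α β γ μ ν, le (i, α) (j, β) →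
    P.IsLM O.le (mon P.x γ * mon P.x β) μ →
    P.IsLM O.le (mon P.x γ * mon P.x α) ν → le (i, ν) (j, μ)
  deg_compat : ∀ X Y, deg X.2 < deg Y.2 → le X Y

/-- The right syzygy module `{b | a_1 b_1 + ⋯ + a_s b_s = 0}`, a right `R`-submodule. -/
def syz {R κ : Type*} [Ring R] [Fintype κ] (a : κ → R) : Submodule Rᵐᵒᵖ (κ → R) where
  carrier := {b | ∑ i, a i * b i = 0}
  add_mem' := by
    intro b b' hb hb'
    simp only [Set.mem_ofPred_eq] at *
    simp [mul_add, Finset.sum_add_distrib, hb, hb']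
  zero_mem' := by simp
  smul_mem' := by
    intro r b hb
    simp only [Set.mem_ofPred_eq] at *
    simp [← mul_assoc, ← Finset.sum_mul, hb]

namespace VecMonOrder

variable {R A : Type*} [Ring R] [Ring A] {n m : ℕ} {P : BijSkewPBWExt R A n} {O : MonOrder P}

/-- `X` is the greatest monomial occurring in `f`. -/
def IsLeadMon (W : VecMonOrder P O m) (f : Fin m → A) (X : Fin m × (Fin n → ℕ)) : Prop :=
  P.coeff (f X.1) X.2 ≠ 0 ∧ ∀ Y : Fin m × (Fin n → ℕ), P.coeff (f Y.1) Y.2 ≠ 0 → W.le Y X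

open Classical in
/-- The leading monomial, with values in `Mon(A^m) ∪ {0}`; the bottom element stands for `0`. -/
noncomputable def lm (W : VecMonOrder P O m) (f : Fin m → A) :
    WithBot (Fin m × (Fin n → ℕ)) :=
  if h : ∃ X, W.IsLeadMon f X then ((h.choose : Fin m × (Fin n → ℕ)) : WithBot _) else ⊥

/-- `exp(lm(f))` (and `0` if `f = 0`). -/
noncomputable def expo (W : VecMonOrder P O m) (f : Fin m → A) : Fin n → ℕ :=
  ((W.lm f).map Prod.snd).unbotD 0

/-- The leading coefficient `lc(f)` (and `0` if `f = 0`). -/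
noncomputable def lc (W : VecMonOrder P O m) (f : Fin m → A) : R :=
  ((W.lm f).map fun X => P.coeff (f X.1) X.2).unbotD 0

/-- One-step reduction of a nonzero vector: `f ↦ h` by `F`. -/
def Red (W : VecMonOrder P O m) (F : Finset (Fin m → A)) (f h : Fin m → A) : Prop :=
  ∃ X : Fin m × (Fin n → ℕ), W.lm f = X ∧
    ∃ (t : ℕ) (g : Fin t → Fin m → A) (r : Fin t → R) (α : Fin t → Fin n → ℕ),
      (∀ i, g i ∈ F) ∧
      (∀ i, ∃ β : Fin n → ℕ,
        W.lm (g i) = ((X.1, β) : Fin m × (Fin n → ℕ)) ∧ β + α i = X.2) ∧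
      W.lc f = ∑ i, W.lc (g i) * P.sigmaPow (W.expo (g i)) (r i) * P.c (W.expo (g i)) (α i) ∧
      h = f - ∑ i, MulOpposite.op (P.ι (r i) * mon P.x (α i)) • g i

/-- `f` is reduced with respect to `F`. -/
def Reduced (W : VecMonOrder P O m) (F : Finset (Fin m → A)) (f : Fin m → A) : Prop :=
  f = 0 ∨ ¬ ∃ h, W.Red F f h

/-- `G` is a Gröbner basis of the right submodule `M` of `A^m`. -/
def IsGroebnerBasis (W : VecMonOrder P O m) (M : Submodule Aᵐᵒᵖ (Fin m → A))
    (G : Finset (Fin m → A)) : Prop :=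
  (M ≠ ⊥ ∧ G.Nonempty ∧ (∀ g ∈ G, g ≠ 0 ∧ g ∈ M) ∧ ∀ f ∈ M, f ≠ 0 → ¬ W.Reduced G f) ∨
    (M = ⊥ ∧ G = {0})

/-- `X` is the nonzero least common multiple `X_S` of the leading monomials of the elements of
`S`; there is such an `X` exactly if these leading monomials have a common index. -/
def IsLcm (W : VecMonOrder P O m) (S : Finset (Fin m → A)) (X : Fin m × (Fin n → ℕ)) : Prop :=
  S.Nonempty ∧ (∀ g ∈ S, W.lm g = ((X.1, W.expo g) : Fin m × (Fin n → ℕ))) ∧ X.2 = S.sup W.expo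

/-- `S_S = Syz_R^r[lc(g) c_{β_g,γ_g}]_{g ∈ S}` with `β_g = exp(lm(g))` and
`γ_g = exp(X_S) - β_g`. -/
noncomputable def syzModule (W : VecMonOrder P O m) (S : Finset (Fin m → A))
    (X : Fin m × (Fin n → ℕ)) : Submodule Rᵐᵒᵖ (S → R) :=
  syz fun g : S => W.lc g.1 * P.c (W.expo g.1) (X.2 - W.expo g.1)

/-- The S-vector `∑_{g ∈ S} g ψ_{β_g,γ_g}⁻¹(b_g) x^{γ_g}`. -/
noncomputable def sVector (W : VecMonOrder P O m) (S : Finset (Fin m → A))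
    (X : Fin m × (Fin n → ℕ)) (b : S → R) : Fin m → A :=
  ∑ g : S, MulOpposite.op
    (P.ι ((P.psi (W.expo g.1) (X.2 - W.expo g.1))⁻¹ (b g)) * mon P.x (X.2 - W.expo g.1)) • g.1

end VecMonOrder

/-- The configurations of the right Buchberger algorithm; `G` and `H` are its two variables
(`H` is the one that grows).
* `test G H`: at the head of the while loop;
* `subsets G H D`: in the loop over the subsets, `D` being those not yet treated;
* `syzygies G H D S X B`: in the loop over the generators of the syzygies of `S`, where `X = X_S`
  and `B` is the set of generators not yet treated;
* `reduce G H D S X B h`: reducing an S-vector, `h` being the current vector;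
* `done G`: stopped, with output `G`. -/
inductive Config (R A : Type*) (n m : ℕ) where
  | test (G H : Finset (Fin m → A))
  | subsets (G H : Finset (Fin m → A)) (D : Finset (Finset (Fin m → A)))
  | syzygies (G H : Finset (Fin m → A)) (D : Finset (Finset (Fin m → A)))
      (S : Finset (Fin m → A)) (X : Fin m × (Fin n → ℕ)) (B : Finset (S → R))
  | reduce (G H : Finset (Fin m → A)) (D : Finset (Finset (Fin m → A)))
      (S : Finset (Fin m → A)) (X : Fin m × (Fin n → ℕ)) (B : Finset (S → R)) (h : Fin m → A)
  | done (G : Finset (Fin m → A))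

open Classical in
/-- One elementary step of the right Buchberger algorithm. The order in which the subsets and the
syzygies are treated, the finite generating sets `B_S` and the single reductions are arbitrary
choices of the execution. -/
inductive Step {R A : Type*} [Ring R] [Ring A] {n m : ℕ} {P : BijSkewPBWExt R A n}
    {O : MonOrder P} (W : VecMonOrder P O m) : Config R A n m → Config R A n m → Prop
  | finish (G) : Step W (.test G G) (.done G)
  | enter (G H) : H ≠ G → Step W (.test G H) (.subsets H H (H.powerset \ G.powerset))
  | subsetsEnd (G H) : Step W (.subsets G H ∅) (.test G H)
  | skip (G H D) (S : Finset (Fin m → A)) : S ∈ D → (¬ ∃ X, W.IsLcm S X) →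
      Step W (.subsets G H D) (.subsets G H (D.erase S))
  | compute (G H D) (S : Finset (Fin m → A)) (X) (B : Finset (S → R)) : S ∈ D → W.IsLcm S X →
      Submodule.span Rᵐᵒᵖ (B : Set (S → R)) = W.syzModule S X →
      Step W (.subsets G H D) (.syzygies G H (D.erase S) S X B)
  | syzygiesEnd (G H D S X) : Step W (.syzygies G H D S X ∅) (.subsets G H D)
  | form (G H D S X B b) : b ∈ B →
      Step W (.syzygies G H D S X B) (.reduce G H D S X (B.erase b) (W.sVector S X b))
  | red (G H D S X B h k) : ¬ W.Reduced H h → W.Red H h k →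
      Step W (.reduce G H D S X B h) (.reduce G H D S X B k)
  | discard (G H D S X B) :
      Step W (.reduce G H D S X B 0) (.syzygies G H D S X B)
  | adjoin (G H D S X B h) : W.Reduced H h → h ≠ 0 →
      Step W (.reduce G H D S X B h) (.syzygies G (insert h H) D S X B)

end SkewPBW

/-! ### Standard monomials and induction on exponents. -/

namespace SkewPBW

/-! Modulo terms of lower degree, (r x^α)(s x^β) is r σ^α(s) c_{α,β} x^{α+β} with c_{α,β} a unit
(`term_mul_term`, `isUnit_c`). Since the orders refine the degree, leading terms of right multiples
in A^m behave as over a polynomial ring, up to twists by σ and c. The rule for these twists comes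
from bracketing a triple product in two ways (`symbol_assoc`).

Correctness is Buchberger's criterion (`exists_red_of_mem_span`). Write f = ∑ g p_g so that no
leading monomial of a g x^ν, with x^ν occurring in p_g, exceeds X. If the coefficient of f at X
vanishes, the top coefficients form a syzygy of the set S of those g whose leading monomial divides
X. This syzygy is an R-combination of generators whose S-vectors have representations with terms
below X_S; multiplying these up to X replaces the top part of the sum by terms below X
(`mem_rep_lt_of_coeffAt_eq_zero`). The order is well-founded, so eventually X = lm(f), and then the
top coefficients are themselves a one-step reduction of f. Over a general R a cancellation may need
many elements at once, which is why all subsets S are treated and not only pairs.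

Termination: by Dickson's lemma and the ascending chain condition on right ideals, nonzero reduced
vectors can be adjoined only finitely often (`wellFounded_adjoins`). Between two adjunctions the
loops are finite and each reduction lowers the leading monomial; a pass that adjoins nothing ends
the while loop. -/

theorem mul_prod_ofFn_pow {M : Type*} [Monoid M] {n : ℕ} (x : Fin n → M) (α : Fin n → ℕ)
    (j : Fin n) (h : ∀ k < j, α k = 0) :
    x j * (List.ofFn fun i => x i ^ α i).prod =
      (List.ofFn fun i => x i ^ (α + Pi.single j 1 : Fin n → ℕ) i).prod := by
  induction n with
  | zero => exact j.elim0
  | succ n ih =>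
    rw [List.ofFn_succ, List.ofFn_succ, List.prod_cons, List.prod_cons]
    induction j using Fin.cases with
    | zero => simp [← mul_assoc, ← pow_succ']
    | succ j =>
      have h0 : α 0 = 0 := h 0 (Fin.succ_pos j)
      have := ih (fun i => x i.succ) (fun i => α i.succ) j
        fun k hk => h k.succ (Fin.succ_lt_succ_iff.2 hk)
      simp only [h0, pow_zero, one_mul, Pi.add_apply]
      rw [this]
      simp [Pi.single_apply]

theorem mul_mon {A : Type*} [Ring A] {n : ℕ} (x : Fin n → A) (α : Fin n → ℕ) (j : Fin n)
    (h : ∀ k < j, α k = 0) : x j * mon x α = mon x (α + Pi.single j 1) :=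
  mul_prod_ofFn_pow x α j h

theorem mon_zero {A : Type*} [Ring A] {n : ℕ} (x : Fin n → A) : mon x 0 = 1 := by
  simp [mon]

theorem mon_single {A : Type*} [Ring A] {n : ℕ} (x : Fin n → A) (j : Fin n) :
    mon x (Pi.single j 1) = x j := by
  have := mul_mon x 0 j (by simp)
  rw [mon_zero, mul_one, zero_add] at this
  exact this.symm

theorem deg_add {n : ℕ} (α β : Fin n → ℕ) : deg (α + β) = deg α + deg β := by
  simp [deg, Finset.sum_add_distrib]

theorem deg_single {n : ℕ} (j : Fin n) : deg (Pi.single j 1 : Fin n → ℕ) = 1 := by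
  simp [deg]

theorem deg_zero {n : ℕ} : deg (0 : Fin n → ℕ) = 0 := by
  simp [deg]

/-- Every nonzero exponent is `α + e_j` with `j` at most every index in the support of `α`. -/
theorem exists_eq_add_single {n : ℕ} {β : Fin n → ℕ} (hβ : β ≠ 0) :
    ∃ (j : Fin n) (α : Fin n → ℕ), (∀ k < j, α k = 0) ∧ β = α + Pi.single j 1 := by
  obtain ⟨j, hj, hmin⟩ := wellFounded_lt.has_min {j | β j ≠ 0} (Function.ne_iff.1 hβ)
  have hlow : ∀ k < j, β k = 0 := fun k hk => by
    by_contra hne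
    exact hmin k hne hk
  refine ⟨j, β - Pi.single j 1, fun k hk => by simp [hlow k hk], ?_⟩
  funext k
  by_cases hk : k = j
  · subst hk
    have : β k ≠ 0 := hj
    simp only [Pi.add_apply, Pi.sub_apply, Pi.single_eq_same]
    omega
  · simp [hk]

/-- Tailored to `mul_mon`: each step multiplies on the left by a variable that already stands in its
place, so no commutation is needed. -/
theorem exponent_induction {n : ℕ} {Q : (Fin n → ℕ) → Prop} (zero : Q 0)
    (add_single : ∀ j α, (∀ k < j, α k = 0) → Q α → Q (α + Pi.single j 1)) (β : Fin n → ℕ) :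
    Q β := by
  induction hd : deg β using Nat.strong_induction_on generalizing β with
  | _ d ih =>
    by_cases hβ : β = 0
    · exact hβ ▸ zero
    · obtain ⟨j, α, hlow, rfl⟩ := exists_eq_add_single hβ
      refine add_single j α hlow (ih (deg α) ?_ α rfl)
      rw [← hd, deg_add, deg_single]
      omega

/-! ### Coefficients, the maps σ_i and the degree filtration. -/

namespace SkewPBWExt

variable {R A : Type*} [Ring R] [Ring A] {n : ℕ} (P : SkewPBWExt R A n)

theorem sum_coeff (a : A) : ((P.coeff a).sum fun α r => P.ι r * mon P.x α) = a :=
  (Equiv.ofBijective _ P.basis).apply_symm_apply a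

theorem coeff_sum (r : (Fin n → ℕ) →₀ R) :
    P.coeff (r.sum fun α s => P.ι s * mon P.x α) = r :=
  (Equiv.ofBijective _ P.basis).symm_apply_apply r

theorem coeff_add (a b : A) : P.coeff (a + b) = P.coeff a + P.coeff b := by
  rw [← P.coeff_sum (P.coeff a + P.coeff b), Finsupp.sum_add_index' (by simp)
    (by simp [add_mul]), P.sum_coeff, P.sum_coeff]

/-- The coefficients, as an additive map. -/
noncomputable def coeffHom : A →+ ((Fin n → ℕ) →₀ R) := AddMonoidHom.mk' P.coeff P.coeff_add

theorem coeff_zero : P.coeff 0 = 0 := P.coeffHom.map_zero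

theorem coeff_sub (a b : A) : P.coeff (a - b) = P.coeff a - P.coeff b := P.coeffHom.map_sub a b

theorem coeff_neg (a : A) : P.coeff (-a) = -P.coeff a := P.coeffHom.map_neg a

theorem coeff_finset_sum {κ : Type*} (s : Finset κ) (f : κ → A) :
    P.coeff (∑ k ∈ s, f k) = ∑ k ∈ s, P.coeff (f k) := map_sum P.coeffHom f s

theorem coeff_ι_mul (r : R) (a : A) : P.coeff (P.ι r * a) = r • P.coeff a := by
  rw [← P.coeff_sum (r • P.coeff a), Finsupp.sum_smul_index (by simp)]
  conv_lhs => rw [← P.sum_coeff a]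
  simp [Finsupp.mul_sum, mul_assoc]

theorem coeff_ι_mul_mon (r : R) (α : Fin n → ℕ) :
    P.coeff (P.ι r * mon P.x α) = Finsupp.single α r := by
  rw [← P.coeff_sum (Finsupp.single α r), Finsupp.sum_single_index (by simp)]

theorem coeff_mon (α : Fin n → ℕ) : P.coeff (mon P.x α) = Finsupp.single α 1 := by
  simpa using P.coeff_ι_mul_mon 1 α

theorem coeff_injective : Function.Injective P.coeff :=
  (Equiv.ofBijective _ P.basis).symm.injective

theorem sigma_spec (i : Fin n) (r : R) :
    ∃ d, P.x i * P.ι r = P.ι (P.sigma i r) * P.x i + P.ι d := by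
  by_cases hr : r = 0
  · subst hr
    exact ⟨0, by simp [sigma, coeff_zero]⟩
  · obtain ⟨c, -, d, hd⟩ := P.exists_coeff i r hr
    have hx : P.x i * P.ι r = P.ι c * mon P.x (Pi.single i 1) + P.ι d * mon P.x 0 := by
      rw [mon_single, mon_zero, mul_one, ← hd]
      abel
    have hc : P.sigma i r = c := by
      rw [sigma, hx, coeff_add, coeff_ι_mul_mon, coeff_ι_mul_mon, Finsupp.add_apply,
        Finsupp.single_eq_same, Finsupp.single_eq_of_ne (by simp), add_zero]
    exact ⟨d, by rw [hx, hc, mon_single, mon_zero, mul_one]⟩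

theorem sigma_eq {i : Fin n} {r s d : R} (h : P.x i * P.ι r = P.ι s * P.x i + P.ι d) :
    P.sigma i r = s := by
  rw [sigma, h, ← mon_single P.x i, ← mul_one (P.ι d), ← mon_zero P.x, coeff_add,
    coeff_ι_mul_mon, coeff_ι_mul_mon, Finsupp.add_apply,
    Finsupp.single_eq_same, Finsupp.single_eq_of_ne (by simp), add_zero]

theorem sigma_one (i : Fin n) : P.sigma i 1 = 1 :=
  P.sigma_eq (d := 0) (by simp)

theorem sigma_mul (i : Fin n) (r s : R) : P.sigma i (r * s) = P.sigma i r * P.sigma i s := by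
  obtain ⟨d, hd⟩ := P.sigma_spec i r
  obtain ⟨e, he⟩ := P.sigma_spec i s
  refine P.sigma_eq (d := P.sigma i r * e + d * s) ?_
  rw [map_mul, ← mul_assoc, hd, add_mul, mul_assoc, he]
  simp only [map_mul, map_add, mul_add]
  noncomm_ring

theorem isUnit_sigma (i : Fin n) {u : R} (hu : IsUnit u) : IsUnit (P.sigma i u) :=
  hu.map (⟨⟨P.sigma i, P.sigma_one i⟩, P.sigma_mul i⟩ : R →* R)

/-- The elements all of whose monomials have degree less than `d`. -/
def low (d : ℕ) : AddSubgroup A where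
  carrier := {a | ∀ ν, P.coeff a ν ≠ 0 → deg ν < d}
  add_mem' := by
    intro a b ha hb ν hν
    by_contra hd
    refine hν ?_
    rw [coeff_add, Finsupp.add_apply, not_imp_comm.1 (ha ν) hd, not_imp_comm.1 (hb ν) hd, add_zero]
  zero_mem' := by simp [coeff_zero]
  neg_mem' := by
    intro a ha ν hν
    exact ha ν (by simpa [coeff_neg] using hν)

theorem low_mono {d e : ℕ} (h : d ≤ e) : P.low d ≤ P.low e :=
  fun _ ha ν hν => (ha ν hν).trans_le h

theorem ι_mul_mem_low {d : ℕ} (r : R) {a : A} (ha : a ∈ P.low d) : P.ι r * a ∈ P.low d := by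
  intro ν hν
  refine ha ν fun h => hν ?_
  rw [coeff_ι_mul, Finsupp.smul_apply, h, smul_zero]

theorem mon_mem_low {d : ℕ} {α : Fin n → ℕ} (h : deg α < d) : mon P.x α ∈ P.low d := by
  intro ν hν
  rw [coeff_mon] at hν
  by_cases he : α = ν
  · exact he ▸ h
  · exact absurd (Finsupp.single_eq_of_ne (Ne.symm he)) hν

theorem ι_mul_mon_mem_low {d : ℕ} (r : R) {α : Fin n → ℕ} (h : deg α < d) :
    P.ι r * mon P.x α ∈ P.low d :=
  P.ι_mul_mem_low r (P.mon_mem_low h)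

/-- Reduces statements about `low d` to single terms; below, S is the preimage of a filtration step
under a multiplication map. -/
theorem low_induction {d : ℕ} {S : AddSubgroup A}
    (h : ∀ r α, deg α < d → P.ι r * mon P.x α ∈ S) : P.low d ≤ S := by
  intro a ha
  rw [← P.sum_coeff a]
  exact S.sum_mem fun α hα => h _ α (ha α (Finsupp.mem_support_iff.1 hα))

theorem coeff_eq_zero_of_mem_low {d : ℕ} {a : A} (ha : a ∈ P.low d) {ν : Fin n → ℕ}
    (hν : d ≤ deg ν) : P.coeff a ν = 0 := by
  by_contra h
  exact absurd (ha ν h) hν.not_gt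

end SkewPBWExt

/-! ### Leading terms of products in A. -/

namespace BijSkewPBWExt

open SkewPBWExt

variable {R A : Type*} [Ring R] [Ring A] {n : ℕ} (P : BijSkewPBWExt R A n)

/-- The bound on x_i x^β is a hypothesis because the lemma is already needed inside the induction
that proves this bound. -/
theorem x_mul_ι_mul_mon_mem_low {d : ℕ} {i : Fin n} {β : Fin n → ℕ} (hβ : deg β < d)
    (h : P.x i * mon P.x β ∈ P.low (d + 1)) (r : R) :
    P.x i * (P.ι r * mon P.x β) ∈ P.low (d + 1) := by
  obtain ⟨e, he⟩ := P.sigma_spec i r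
  rw [← mul_assoc, he, add_mul, mul_assoc]
  exact add_mem (P.ι_mul_mem_low _ h) (P.ι_mul_mon_mem_low _ (by omega))

/-- If x_i is not in its place, write x^β = x_j x^α with j < i, swap x_i and x_j at the cost of a
unit and of terms of lower degree, and apply the induction hypothesis to x_i x^α. Units survive
because σ_j is multiplicative and fixes 1. -/
theorem exists_unit_x_mul_mon (i : Fin n) (β : Fin n → ℕ) :
    ∃ u : R, IsUnit u ∧
      P.x i * mon P.x β - P.ι u * mon P.x (β + Pi.single i 1) ∈ P.low (deg β + 1) := by
  induction hd : deg β using Nat.strong_induction_on generalizing β i with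
  | _ d ih =>
    by_cases hβ : ∀ k < i, β k = 0
    · exact ⟨1, isUnit_one, by simp [mul_mon P.x β i hβ]⟩
    have hβ0 : β ≠ 0 := by
      rintro rfl
      simp at hβ
    obtain ⟨j, α, hlow, rfl⟩ := exists_eq_add_single hβ0
    rw [deg_add, deg_single] at hd
    have hji : j < i := by
      by_contra hij
      refine hβ fun k hk => ?_
      have hkj : k < j := hk.trans_le (not_lt.1 hij)
      simp [hlow k hkj, hkj.ne]
    have hmem : ∀ k γ, deg γ < d → P.x k * mon P.x γ ∈ P.low (deg γ + 2) := by
      intro k γ hγ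
      obtain ⟨u, -, hu⟩ := ih _ hγ k γ rfl
      rw [← sub_add_cancel (P.x k * mon P.x γ) (P.ι u * mon P.x (γ + Pi.single k 1))]
      exact add_mem (P.low_mono (by omega) hu)
        (P.ι_mul_mon_mem_low _ (by rw [deg_add, deg_single]; omega))
    obtain ⟨u, hu, hp⟩ := ih (deg α) (by omega) i α rfl
    obtain ⟨c, d₀, e, hc⟩ := P.exists_unit_comm j i
    obtain ⟨δ, hδ⟩ := P.sigma_spec j u
    refine ⟨c * P.sigma j u, c.isUnit.mul (P.isUnit_sigma j hu), ?_⟩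
    set p := P.x i * mon P.x α - P.ι u * mon P.x (α + Pi.single i 1) with hpdef
    have hxj : P.x j * mon P.x (α + Pi.single i 1) =
        mon P.x (α + Pi.single j 1 + Pi.single i 1) := by
      rw [mul_mon P.x _ j, add_right_comm]
      intro k hk
      simp [hlow k hk, (hk.trans hji).ne]
    -- The general fact that x_j raises the filtration by one is not yet available; for the terms of
    -- p it follows from the induction hypothesis through `hmem`.
    have hxp : P.x j * p ∈ P.low (d + 1) := by
      refine P.low_induction (S := (P.low (d + 1)).comap (AddMonoidHom.mulLeft (P.x j)))
        (d := d) ?_ (P.low_mono (by omega) hp)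
      intro r γ hγ
      exact P.x_mul_ι_mul_mon_mem_low hγ (P.low_mono (by omega) (hmem j γ hγ)) r
    have key : P.x i * mon P.x (α + Pi.single j 1) -
        P.ι (c * P.sigma j u) * mon P.x (α + Pi.single j 1 + Pi.single i 1) =
        P.ι c * (P.ι δ * mon P.x (α + Pi.single i 1) + P.x j * p) +
          (P.ι d₀ * mon P.x α + ∑ k, P.ι (e k) * (P.x k * mon P.x α)) := by
      have h1 : P.x i * mon P.x α = P.ι u * mon P.x (α + Pi.single i 1) + p := by
        rw [hpdef]; abel
      have h2 : P.x i * P.x j = P.ι c * (P.x j * P.x i) + (P.ι d₀ + ∑ k, P.ι (e k) * P.x k) := by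
        rw [← hc]; abel
      rw [← mul_mon P.x α j hlow, ← mul_assoc, h2, add_mul, mul_assoc (P.ι c),
        mul_assoc (P.x j), h1, mul_add (P.x j), ← mul_assoc (P.x j), hδ, add_mul (_ * _),
        mul_assoc _ (P.x j), hxj, map_mul, add_mul (P.ι d₀), Finset.sum_mul]
      simp only [mul_add, mul_assoc]
      abel
    rw [key]
    refine add_mem (P.ι_mul_mem_low _ (add_mem (P.ι_mul_mon_mem_low _ ?_) hxp))
      (add_mem (P.ι_mul_mon_mem_low _ (by omega)) (sum_mem fun k _ => P.ι_mul_mem_low _ ?_))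
    · rw [deg_add, deg_single]; omega
    · exact P.low_mono (by omega) (hmem k α (by omega))

theorem x_mul_mem_low (i : Fin n) {d : ℕ} {a : A} (ha : a ∈ P.low d) :
    P.x i * a ∈ P.low (d + 1) := by
  refine P.low_induction (S := (P.low (d + 1)).comap (AddMonoidHom.mulLeft (P.x i))) ?_ ha
  intro r β hβ
  refine P.x_mul_ι_mul_mon_mem_low hβ ?_ r
  obtain ⟨u, -, hu⟩ := P.exists_unit_x_mul_mon i β
  rw [← sub_add_cancel (P.x i * mon P.x β) (P.ι u * mon P.x (β + Pi.single i 1))]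
  exact add_mem (P.low_mono (by omega) hu)
    (P.ι_mul_mon_mem_low _ (by rw [deg_add, deg_single]; omega))

theorem mon_mul_mem_low (α : Fin n → ℕ) {d : ℕ} {a : A} (ha : a ∈ P.low d) :
    mon P.x α * a ∈ P.low (deg α + d) := by
  induction α using exponent_induction with
  | zero => simpa [mon_zero, deg_zero] using ha
  | add_single j α hlow ih =>
    rw [← mul_mon P.x α j hlow, mul_assoc]
    exact P.low_mono (by rw [deg_add, deg_single]; omega) (P.x_mul_mem_low j ih)

/-- Membership in `low (e + 1)` means degree at most e; this form avoids the truncated subtraction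
in d + e - 1. -/
theorem mul_mem_low {d e : ℕ} {a b : A} (ha : a ∈ P.low d) (hb : b ∈ P.low (e + 1)) :
    a * b ∈ P.low (d + e) := by
  refine P.low_induction (S := (P.low (d + e)).comap (AddMonoidHom.mulRight b)) ?_ ha
  intro r α hα
  change P.ι r * mon P.x α * b ∈ P.low (d + e)
  rw [mul_assoc]
  exact P.ι_mul_mem_low _ (P.low_mono (by omega) (P.mon_mul_mem_low α hb))

theorem sigmaPow_add_single (α : Fin n → ℕ) (j : Fin n) (h : ∀ k < j, α k = 0) (s : R) :
    P.sigmaPow (α + Pi.single j 1) s = P.sigma j (P.sigmaPow α s) := by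
  rw [sigmaPow, ← mul_prod_ofFn_pow _ α j h]
  rfl

theorem sigmaPow_zero (s : R) : P.sigmaPow 0 s = s := by
  simp [sigmaPow]

theorem mon_mul_ι (α : Fin n → ℕ) (s : R) :
    mon P.x α * P.ι s - P.ι (P.sigmaPow α s) * mon P.x α ∈ P.low (deg α) := by
  induction α using exponent_induction with
  | zero => simp [mon_zero, sigmaPow_zero]
  | add_single j α hlow ih =>
    obtain ⟨δ, hδ⟩ := P.sigma_spec j (P.sigmaPow α s)
    have : mon P.x (α + Pi.single j 1) * P.ι s -
        P.ι (P.sigmaPow (α + Pi.single j 1) s) * mon P.x (α + Pi.single j 1) =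
        P.x j * (mon P.x α * P.ι s - P.ι (P.sigmaPow α s) * mon P.x α) +
          P.ι δ * mon P.x α := by
      rw [sigmaPow_add_single P α j hlow, ← mul_mon P.x α j hlow, mul_sub,
        ← mul_assoc (P.x j) (P.ι _), hδ, add_mul, mul_assoc, mul_assoc]
      abel
    rw [this, deg_add, deg_single]
    exact add_mem (P.x_mul_mem_low j ih) (P.ι_mul_mon_mem_low _ (by omega))

theorem exists_unit_mon_mul_mon (α β : Fin n → ℕ) :
    ∃ u : R, IsUnit u ∧
      mon P.x α * mon P.x β - P.ι u * mon P.x (α + β) ∈ P.low (deg α + deg β) := by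
  induction α using exponent_induction with
  | zero => exact ⟨1, isUnit_one, by simp [mon_zero]⟩
  | add_single j α hlow ih =>
    obtain ⟨u, hu, hp⟩ := ih
    obtain ⟨v, hv, hq⟩ := P.exists_unit_x_mul_mon j (α + β)
    obtain ⟨δ, hδ⟩ := P.sigma_spec j u
    refine ⟨P.sigma j u * v, (P.isUnit_sigma j hu).mul hv, ?_⟩
    have : mon P.x (α + Pi.single j 1) * mon P.x β -
        P.ι (P.sigma j u * v) * mon P.x (α + Pi.single j 1 + β) =
        P.x j * (mon P.x α * mon P.x β - P.ι u * mon P.x (α + β)) +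
          (P.ι (P.sigma j u) *
            (P.x j * mon P.x (α + β) - P.ι v * mon P.x (α + β + Pi.single j 1)) +
          P.ι δ * mon P.x (α + β)) := by
      rw [← mul_mon P.x α j hlow, add_right_comm, mul_sub, ← mul_assoc (P.x j) (P.ι u), hδ, add_mul,
        mul_sub, map_mul]
      simp only [mul_assoc]
      abel
    rw [this]
    rw [deg_add] at hq
    refine add_mem (P.low_mono ?_ (P.x_mul_mem_low j hp))
      (add_mem (P.low_mono ?_ (P.ι_mul_mem_low _ hq)) (P.ι_mul_mon_mem_low _ ?_)) <;>
    · simp only [deg_add, deg_single]; omega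

theorem mon_mul_mon (α β : Fin n → ℕ) :
    IsUnit (P.c α β) ∧
      mon P.x α * mon P.x β - P.ι (P.c α β) * mon P.x (α + β) ∈ P.low (deg α + deg β) := by
  obtain ⟨u, hu, hp⟩ := P.exists_unit_mon_mul_mon α β
  have h0 := P.coeff_eq_zero_of_mem_low hp (deg_add α β).ge
  rw [coeff_sub, coeff_ι_mul_mon, Finsupp.sub_apply, Finsupp.single_eq_same, sub_eq_zero] at h0
  have : P.c α β = u := h0
  rw [this]
  exact ⟨hu, hp⟩

theorem isUnit_c (α β : Fin n → ℕ) : IsUnit (P.c α β) := (P.mon_mul_mon α β).1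

/-- The leading term of a product of two terms. -/
theorem term_mul_term (r s : R) (α β : Fin n → ℕ) :
    P.ι r * mon P.x α * (P.ι s * mon P.x β) -
      P.ι (r * P.sigmaPow α s * P.c α β) * mon P.x (α + β) ∈ P.low (deg α + deg β) := by
  have : P.ι r * mon P.x α * (P.ι s * mon P.x β) -
      P.ι (r * P.sigmaPow α s * P.c α β) * mon P.x (α + β) =
      P.ι r * ((mon P.x α * P.ι s - P.ι (P.sigmaPow α s) * mon P.x α) * mon P.x β +
        P.ι (P.sigmaPow α s) *
          (mon P.x α * mon P.x β - P.ι (P.c α β) * mon P.x (α + β))) := by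
    simp only [map_mul]
    noncomm_ring
  rw [this]
  exact P.ι_mul_mem_low _ (add_mem
    (P.mul_mem_low (P.mon_mul_ι α s) (P.mon_mem_low (Nat.lt_succ_self _)))
    (P.ι_mul_mem_low _ (P.mon_mul_mon α β).2))

theorem coeff_term_mul_term (r s : R) (α β : Fin n → ℕ) :
    P.coeff (P.ι r * mon P.x α * (P.ι s * mon P.x β)) (α + β) =
      r * P.sigmaPow α s * P.c α β := by
  have h := P.coeff_eq_zero_of_mem_low (P.term_mul_term r s α β) (deg_add α β).ge
  rw [coeff_sub, coeff_ι_mul_mon, Finsupp.sub_apply, Finsupp.single_eq_same, sub_eq_zero] at h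
  exact h

theorem eq_or_deg_lt_of_coeff_term_mul_term {r s : R} {α β ν : Fin n → ℕ}
    (h : P.coeff (P.ι r * mon P.x α * (P.ι s * mon P.x β)) ν ≠ 0) :
    ν = α + β ∨ deg ν < deg (α + β) := by
  by_contra! hne
  have h0 := P.coeff_eq_zero_of_mem_low (P.term_mul_term r s α β) ((deg_add α β).ge.trans hne.2)
  rw [coeff_sub, coeff_ι_mul_mon, Finsupp.sub_apply, Finsupp.single_eq_of_ne hne.1,
    sub_zero] at h0
  exact h h0

/-- Makes the additivity of σ^α evident, although σ^α was built only as a permutation. -/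
theorem sigmaPow_eq_coeff (α : Fin n → ℕ) (s : R) :
    P.sigmaPow α s = P.coeff (mon P.x α * P.ι s) α := by
  have h := P.coeff_eq_zero_of_mem_low (P.mon_mul_ι α s) le_rfl
  rw [coeff_sub, coeff_ι_mul_mon, Finsupp.sub_apply, Finsupp.single_eq_same, sub_eq_zero] at h
  exact h.symm

theorem sigmaPow_add (α : Fin n → ℕ) (s t : R) :
    P.sigmaPow α (s + t) = P.sigmaPow α s + P.sigmaPow α t := by
  simp only [sigmaPow_eq_coeff, map_add, mul_add, coeff_add, Finsupp.add_apply]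

theorem sigmaPow_map_zero (α : Fin n → ℕ) : P.sigmaPow α 0 = 0 := by
  simp [sigmaPow_eq_coeff, coeff_zero]

theorem sigmaPow_map_one (α : Fin n → ℕ) : P.sigmaPow α 1 = 1 := by
  simp [sigmaPow_eq_coeff, coeff_mon]

theorem c_zero_right (α : Fin n → ℕ) : P.c α 0 = 1 := by
  simp [SkewPBWExt.c, mon_zero, coeff_mon]

/-- Associativity of the multiplication of leading terms. -/
theorem symbol_assoc (β γ δ : Fin n → ℕ) (r s : R) :
    P.sigmaPow β (r * P.sigmaPow γ s * P.c γ δ) * P.c β (γ + δ) =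
      P.sigmaPow β r * P.c β γ * P.sigmaPow (β + γ) s * P.c (β + γ) δ := by
  have hs : P.ι s * mon P.x δ ∈ P.low (deg δ + 1) := P.ι_mul_mon_mem_low _ (Nat.lt_succ_self _)
  have h1 := P.mul_mem_low (P.term_mul_term 1 r β γ) hs
  have h2 := P.mon_mul_mem_low β (P.term_mul_term r s γ δ)
  have h3 := P.term_mul_term 1 (r * P.sigmaPow γ s * P.c γ δ) β (γ + δ)
  have h4 := P.term_mul_term (P.sigmaPow β r * P.c β γ) s (β + γ) δ
  simp only [map_one, one_mul] at h1 h3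
  -- Both sums approximate the same triple product, so it cancels and the two candidate leading
  -- terms differ by an element of lower degree.
  have h := sub_mem (add_mem (P.low_mono (by simp only [deg_add]; omega) h1) h4)
    (add_mem (P.low_mono (by simp only [deg_add]; omega) h2)
      (P.low_mono (by simp only [deg_add]; omega) h3))
  simp only [sub_mul, mul_sub, mul_assoc, sub_add_sub_cancel, add_assoc] at h
  rw [sub_sub_sub_cancel_left, ← sub_mul, ← map_sub] at h
  have h0 := P.coeff_eq_zero_of_mem_low h (ν := β + (γ + δ)) (by simp only [deg_add]; omega)
  rw [coeff_ι_mul_mon, Finsupp.single_eq_same, sub_eq_zero] at h0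
  simpa only [mul_assoc] using h0

/-- This is the purpose of ψ: it moves b from the right of c_{β,γ} to the inside of σ^β, so that the
top coefficient of an S-vector is exactly the syzygy sum. -/
theorem sigmaPow_psi_inv_mul_c (β γ : Fin n → ℕ) (b : R) :
    P.sigmaPow β ((P.psi β γ)⁻¹ b) * P.c β γ = P.c β γ * b := by
  obtain ⟨s, rfl⟩ := (P.sigmaPow (β + γ)).surjective b
  have h := P.symbol_assoc β γ 0 1 s
  simp only [c_zero_right, sigmaPow_map_one, add_zero, one_mul, mul_one] at h
  rw [← h]
  congr 2
  rw [Equiv.Perm.inv_eq_iff_eq]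
  exact congrArg _ ((P.sigmaPow γ).symm_apply_apply s).symm

theorem exists_sigmaPow_mul_c (β γ : Fin n → ℕ) (t : R) :
    ∃ r, P.sigmaPow β r * P.c β γ = t := by
  obtain ⟨u, hu⟩ := P.isUnit_c β γ
  obtain ⟨r, hr⟩ := (P.sigmaPow β).surjective (t * ↑u⁻¹)
  exact ⟨r, by rw [hr, ← hu, mul_assoc, Units.inv_mul, mul_one]⟩

theorem sigmaPow_mul_c_injective (β γ : Fin n → ℕ) :
    Function.Injective fun r => P.sigmaPow β r * P.c β γ :=
  fun _ _ h => (P.sigmaPow β).injective ((P.isUnit_c β γ).mul_left_injective h)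

end BijSkewPBWExt

end SkewPBW

namespace SkewPBW

open MulOpposite

/-! ### Coefficients of products and of vectors. -/

namespace BijSkewPBWExt

open SkewPBWExt

variable {R A : Type*} [Ring R] [Ring A] {n m : ℕ} (P : BijSkewPBWExt R A n)

theorem coeff_mul_apply (a b : A) (μ : Fin n → ℕ) :
    P.coeff (a * b) μ = ∑ ν ∈ (P.coeff a).support, ∑ κ ∈ (P.coeff b).support,
      P.coeff (P.ι (P.coeff a ν) * mon P.x ν * (P.ι (P.coeff b κ) * mon P.x κ)) μ := by
  conv_lhs => rw [← P.sum_coeff a, ← P.sum_coeff b]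
  simp only [Finsupp.sum, Finset.sum_mul_sum, coeff_finset_sum, Finset.sum_apply']

theorem exists_of_coeff_mul_ne_zero {a b : A} {μ : Fin n → ℕ} (h : P.coeff (a * b) μ ≠ 0) :
    ∃ ν κ, P.coeff a ν ≠ 0 ∧ P.coeff b κ ≠ 0 ∧ (μ = ν + κ ∨ deg μ < deg (ν + κ)) := by
  rw [coeff_mul_apply] at h
  obtain ⟨ν, hν, h⟩ := Finset.exists_ne_zero_of_sum_ne_zero h
  obtain ⟨κ, hκ, h⟩ := Finset.exists_ne_zero_of_sum_ne_zero h
  exact ⟨ν, κ, Finsupp.mem_support_iff.1 hν, Finsupp.mem_support_iff.1 hκ,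
    P.eq_or_deg_lt_of_coeff_term_mul_term h⟩

theorem eq_of_coeff_term_ne_zero {r : R} {α ν : Fin n → ℕ}
    (h : P.coeff (P.ι r * mon P.x α) ν ≠ 0) : ν = α := by
  rw [coeff_ι_mul_mon] at h
  by_contra hne
  exact h (Finsupp.single_eq_of_ne hne)

/-- The coefficient of the monomial `Y` in a vector. -/
noncomputable def coeffAt (Y : Fin m × (Fin n → ℕ)) : (Fin m → A) →+ R :=
  (Finsupp.applyAddHom Y.2).comp (P.coeffHom.comp (Pi.evalAddMonoidHom _ Y.1))

theorem coeffAt_apply (Y : Fin m × (Fin n → ℕ)) (f : Fin m → A) :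
    P.coeffAt Y f = P.coeff (f Y.1) Y.2 := rfl

theorem coeffAt_smul (Y : Fin m × (Fin n → ℕ)) (p : A) (f : Fin m → A) :
    P.coeffAt Y (op p • f) = P.coeff (f Y.1 * p) Y.2 := rfl

theorem finite_coeffAt_ne_zero (f : Fin m → A) : {Y | P.coeffAt Y f ≠ 0}.Finite := by
  refine ((Set.finite_iUnion fun i : Fin m =>
    ((P.coeff (f i)).support.finite_toSet.image (Prod.mk i)))).subset ?_
  intro Y hY
  exact Set.mem_iUnion.2 ⟨Y.1, Y.2, Finsupp.mem_support_iff.2 hY, rfl⟩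

theorem eq_zero_of_coeffAt {f : Fin m → A} (h : ∀ Y, P.coeffAt Y f = 0) : f = 0 := by
  funext i
  refine P.coeff_injective ?_
  ext ν
  rw [Pi.zero_apply, coeff_zero]
  exact h (i, ν)

theorem isLM_mon_mul_mon [Nontrivial R] (O : MonOrder P) (γ α : Fin n → ℕ) :
    P.IsLM O.le (mon P.x γ * mon P.x α) (γ + α) := by
  refine ⟨(P.isUnit_c γ α).ne_zero, fun ν hν => ?_⟩
  rcases P.eq_or_deg_lt_of_coeff_term_mul_term (r := 1) (s := 1) (α := γ) (β := α) (ν := ν)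
    (by simpa using hν) with rfl | h
  · exact O.refl _
  · exact O.deg_compat _ _ h

end BijSkewPBWExt

/-! ### Leading monomials in A^m and of right multiples. -/

namespace VecMonOrder

open BijSkewPBWExt SkewPBWExt

variable {R A : Type*} [Ring R] [Ring A] {n m : ℕ} {P : BijSkewPBWExt R A n} {O : MonOrder P}
  (W : VecMonOrder P O m)

/-- The strict order on `Mon(A^m)`. -/
def lt (X Y : Fin m × (Fin n → ℕ)) : Prop := W.le X Y ∧ X ≠ Y

theorem lt_of_le_of_lt {X Y Z : Fin m × (Fin n → ℕ)} (h : W.le X Y) (h' : W.lt Y Z) :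
    W.lt X Z := by
  refine ⟨W.trans _ _ _ h h'.1, ?_⟩
  rintro rfl
  exact h'.2 (W.antisymm _ _ h'.1 h)

theorem lt_of_deg_lt {X Y : Fin m × (Fin n → ℕ)} (h : deg X.2 < deg Y.2) : W.lt X Y := by
  refine ⟨W.deg_compat _ _ h, ?_⟩
  rintro rfl
  exact h.false

theorem deg_le_of_le {X Y : Fin m × (Fin n → ℕ)} (h : W.le X Y) : deg X.2 ≤ deg Y.2 := by
  by_contra! hlt
  exact (W.lt_of_le_of_lt h (W.lt_of_deg_lt hlt)).2 rfl

/-- The order refines the degree, so only finitely many monomials lie below a given one; their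
number is a decreasing measure. -/
theorem wellFounded_lt : WellFounded W.lt := by
  have hfin : ∀ X, {Y | W.lt Y X}.Finite := fun X => by
    refine ((Set.finite_univ (α := Fin m)).prod
      (Set.finite_Iic (fun _ : Fin n => deg X.2))).subset ?_
    rintro Y hY
    refine ⟨Set.mem_univ _, fun i => ?_⟩
    exact (Finset.single_le_sum (f := Y.2) (fun _ _ => Nat.zero_le _) (Finset.mem_univ i)).trans
      (W.deg_le_of_le hY.1)
  refine Subrelation.wf (r := InvImage (· < ·) fun X => {Y | W.lt Y X}.ncard) ?_
    (InvImage.wf _ Nat.lt_wfRel.wf)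
  intro X Y hXY
  refine Set.ncard_lt_ncard ⟨fun Z hZ => W.lt_of_le_of_lt hZ.1 hXY, fun h => ?_⟩ (hfin Y)
  exact (h hXY : W.lt X X).2 rfl

theorem exists_max {T : Set (Fin m × (Fin n → ℕ))} (hT : T.Finite) (hne : T.Nonempty) :
    ∃ X ∈ T, ∀ Y ∈ T, W.le Y X := by
  induction T, hT using Set.Finite.induction_on with
  | empty => exact absurd hne Set.not_nonempty_empty
  | @insert Z T _ _ ih =>
    rcases T.eq_empty_or_nonempty with rfl | hT
    · exact ⟨Z, Set.mem_insert _ _, by simp [W.refl]⟩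
    obtain ⟨X, hX, hmax⟩ := ih hT
    rcases W.total X Z with h | h
    · refine ⟨Z, Set.mem_insert _ _, fun Y hY => ?_⟩
      rcases hY with rfl | hY
      · exact W.refl _
      · exact W.trans _ _ _ (hmax Y hY) h
    · refine ⟨X, Set.mem_insert_of_mem _ hX, fun Y hY => ?_⟩
      rcases hY with rfl | hY
      · exact h
      · exact hmax Y hY

theorem lm_eq_iff {f : Fin m → A} {X : Fin m × (Fin n → ℕ)} :
    W.lm f = X ↔ W.IsLeadMon f X := by
  unfold lm
  split_ifs with h
  · rw [WithBot.coe_inj]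
    refine ⟨fun hX => hX ▸ h.choose_spec, fun hX => ?_⟩
    exact W.antisymm _ _ (hX.2 _ h.choose_spec.1) (h.choose_spec.2 _ hX.1)
  · exact ⟨fun hX => absurd hX WithBot.bot_ne_coe, fun hX => absurd ⟨X, hX⟩ h⟩

theorem expo_eq {f : Fin m → A} {X : Fin m × (Fin n → ℕ)} (h : W.lm f = X) :
    W.expo f = X.2 := by
  simp [expo, h]

theorem lc_eq {f : Fin m → A} {X : Fin m × (Fin n → ℕ)} (h : W.lm f = X) :
    W.lc f = P.coeffAt X f := by
  simp [lc, h, coeffAt_apply]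

theorem exists_lm_eq {f : Fin m → A} (hf : f ≠ 0) : ∃ X : Fin m × (Fin n → ℕ), W.lm f = X := by
  have hne : {Y | P.coeffAt Y f ≠ 0}.Nonempty := by
    by_contra h
    exact hf (P.eq_zero_of_coeffAt fun Y => not_not.1 fun hY => h ⟨Y, hY⟩)
  obtain ⟨X, hX, hmax⟩ := W.exists_max (P.finite_coeffAt_ne_zero f) hne
  exact ⟨X, W.lm_eq_iff.2 ⟨hX, hmax⟩⟩

theorem le_lm {f : Fin m → A} {X Y : Fin m × (Fin n → ℕ)} (h : W.lm f = X)
    (hY : P.coeffAt Y f ≠ 0) : W.le Y X :=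
  (W.lm_eq_iff.1 h).2 Y hY

theorem coeffAt_lm_ne_zero {f : Fin m → A} {X : Fin m × (Fin n → ℕ)} (h : W.lm f = X) :
    P.coeffAt X f ≠ 0 :=
  (W.lm_eq_iff.1 h).1

section Nontrivial

variable [Nontrivial R]

theorem add_right_mono {i j : Fin m} {α β : Fin n → ℕ} (h : W.le (i, α) (j, β))
    (γ : Fin n → ℕ) : W.le (i, α + γ) (j, β + γ) := by
  rw [add_comm α, add_comm β]
  exact W.mul_mono _ _ _ _ γ _ _ h (P.isLM_mon_mul_mon O γ β) (P.isLM_mon_mul_mon O γ α)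

theorem add_right_strictMono {i j : Fin m} {α β : Fin n → ℕ} (h : W.lt (i, α) (j, β))
    (γ : Fin n → ℕ) : W.lt (i, α + γ) (j, β + γ) := by
  refine ⟨W.add_right_mono h.1 γ, fun he => h.2 ?_⟩
  rw [Prod.mk.injEq] at he
  rw [he.1, add_right_cancel he.2]

theorem exists_of_coeffAt_smul_ne_zero {g : Fin m → A} {X Y : Fin m × (Fin n → ℕ)}
    (hg : W.lm g = X) {p : A} (h : P.coeffAt Y (op p • g) ≠ 0) :
    ∃ ν, P.coeff p ν ≠ 0 ∧ W.le Y (X.1, X.2 + ν) := by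
  rw [coeffAt_smul] at h
  obtain ⟨ν, κ, hν, hκ, hY⟩ := P.exists_of_coeff_mul_ne_zero h
  have hle : W.le (Y.1, ν + κ) (X.1, X.2 + κ) :=
    W.add_right_mono (W.le_lm (Y := (Y.1, ν)) hg hν) κ
  refine ⟨κ, hκ, W.trans _ _ _ ?_ hle⟩
  rcases hY with hY | hY
  · rw [← hY]
    exact W.refl _
  · exact W.deg_compat _ _ hY

theorem coeffAt_smul_eq {g : Fin m → A} {X : Fin m × (Fin n → ℕ)}
    (hg : W.lm g = X) {p : A} {α : Fin n → ℕ}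
    (h : ∀ ν, P.coeff p ν ≠ 0 → W.le (X.1, X.2 + ν) (X.1, X.2 + α)) :
    P.coeffAt (X.1, X.2 + α) (op p • g) =
      W.lc g * P.sigmaPow X.2 (P.coeff p α) * P.c X.2 α := by
  -- Since ν + κ ⪯ X.2 + κ ⪯ X.2 + α at the index X.1, only the product of the two top terms can
  -- reach X.2 + α.
  have hone : ∀ ν κ, P.coeff (g X.1) ν ≠ 0 → P.coeff p κ ≠ 0 →
      P.coeff (P.ι (P.coeff (g X.1) ν) * mon P.x ν * (P.ι (P.coeff p κ) * mon P.x κ))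
        (X.2 + α) ≠ 0 → ν = X.2 ∧ κ = α := by
    intro ν κ hν hκ hne
    have h1 : W.le (X.1, ν + κ) (X.1, X.2 + κ) :=
      W.add_right_mono (W.le_lm (Y := (X.1, ν)) hg hν) κ
    have h2 := h κ hκ
    rcases P.eq_or_deg_lt_of_coeff_term_mul_term hne with he | hlt
    · rw [← he] at h1
      have h3 := congrArg Prod.snd (W.antisymm _ _ h2 h1)
      have hκα : κ = α := add_left_cancel h3
      subst hκα
      exact ⟨(add_right_cancel he).symm, rfl⟩
    · exact absurd (W.deg_le_of_le (W.trans _ _ _ h1 h2)) hlt.not_ge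
  rw [coeffAt_smul, coeff_mul_apply, Finset.sum_eq_single X.2, Finset.sum_eq_single α,
    coeff_term_mul_term, W.lc_eq hg, coeffAt_apply]
  · intro κ hκ hne
    by_contra h0
    by_cases hX : P.coeff (g X.1) X.2 = 0
    · exact W.coeffAt_lm_ne_zero hg hX
    · exact hne (hone _ _ hX (Finsupp.mem_support_iff.1 hκ) h0).2
  · intro hα
    rw [Finsupp.notMem_support_iff.1 hα]
    simp [coeff_zero]
  · intro ν hν hne
    refine Finset.sum_eq_zero fun κ hκ => ?_
    by_contra h0
    exact hne (hone _ _ (Finsupp.mem_support_iff.1 hν) (Finsupp.mem_support_iff.1 hκ) h0).1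
  · intro hX
    exact absurd (Finsupp.notMem_support_iff.1 hX) (W.coeffAt_lm_ne_zero hg)

end Nontrivial

/-! ### Representations with bounded terms. -/

/-- The vectors `∑ g p_g` (`g ∈ H`) such that the leading monomials of all the
`g x^ν` with `x^ν` occurring in `p_g` lie in `U`. -/
def rep (H : Finset (Fin m → A)) (U : Set (Fin m × (Fin n → ℕ))) :
    AddSubgroup (Fin m → A) where
  carrier := {f | ∃ p : (Fin m → A) → A,
    (∀ g ∈ H, ∀ Y : Fin m × (Fin n → ℕ), W.lm g = Y → ∀ ν, P.coeff (p g) ν ≠ 0 →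
      (Y.1, Y.2 + ν) ∈ U) ∧ f = ∑ g ∈ H, op (p g) • g}
  add_mem' := by
    rintro _ _ ⟨p, hp, rfl⟩ ⟨q, hq, rfl⟩
    refine ⟨p + q, fun g hg Y hY ν hν => ?_, by simp [add_smul, Finset.sum_add_distrib]⟩
    by_contra hU
    refine hν ?_
    rw [Pi.add_apply, coeff_add, Finsupp.add_apply, not_imp_comm.1 (hp g hg Y hY ν) hU,
      not_imp_comm.1 (hq g hg Y hY ν) hU, add_zero]
  zero_mem' := ⟨0, by simp [coeff_zero], by simp⟩
  neg_mem' := by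
    rintro _ ⟨p, hp, rfl⟩
    exact ⟨-p, fun g hg Y hY ν hν => hp g hg Y hY ν (by simpa [coeff_neg] using hν), by simp⟩

variable {W}

theorem smul_mem_rep {H : Finset (Fin m → A)} {U : Set (Fin m × (Fin n → ℕ))} {g : Fin m → A}
    (hg : g ∈ H) {p : A} (hp : ∀ Y : Fin m × (Fin n → ℕ), W.lm g = Y → ∀ ν, P.coeff p ν ≠ 0 →
      (Y.1, Y.2 + ν) ∈ U) : op p • g ∈ W.rep H U := by
  classical
  refine ⟨fun g' => if g' = g then p else 0, fun g' _ Y hY ν hν => ?_, ?_⟩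
  · by_cases he : g' = g
    · subst he
      exact hp Y hY ν (by simpa using hν)
    · simp [he, coeff_zero] at hν
  · rw [Finset.sum_eq_single g (fun g' _ he => by simp [he]) (fun h => absurd hg h)]
    simp

theorem rep_mono {H H' : Finset (Fin m → A)} {U U' : Set (Fin m × (Fin n → ℕ))} (hH : H ⊆ H')
    (hU : U ⊆ U') : W.rep H U ≤ W.rep H' U' := by
  rintro _ ⟨p, hp, rfl⟩
  exact sum_mem fun g hg => smul_mem_rep (hH hg) fun Y hY ν hν => hU (hp g hg Y hY ν hν)

theorem mem_span_of_mem_rep {H : Finset (Fin m → A)} {U : Set (Fin m × (Fin n → ℕ))}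
    {f : Fin m → A} (hf : f ∈ W.rep H U) : f ∈ Submodule.span Aᵐᵒᵖ (H : Set (Fin m → A)) := by
  obtain ⟨p, -, rfl⟩ := hf
  exact sum_mem fun g hg => Submodule.smul_mem _ _ (Submodule.subset_span hg)

theorem mem_rep_univ {H : Finset (Fin m → A)} {f : Fin m → A}
    (hf : f ∈ Submodule.span Aᵐᵒᵖ (H : Set (Fin m → A))) : f ∈ W.rep H Set.univ := by
  obtain ⟨a, -, rfl⟩ := Submodule.mem_span_finset.1 hf
  exact ⟨fun g => (a g).unop, by simp, by simp⟩

theorem exists_mem_rep_le {H : Finset (Fin m → A)} {U : Set (Fin m × (Fin n → ℕ))}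
    {f : Fin m → A} (hf : f ∈ W.rep H U) (h0 : f ≠ 0) :
    ∃ X ∈ U, f ∈ W.rep H {Y | W.le Y X} := by
  obtain ⟨p, hp, rfl⟩ := hf
  let T : Set (Fin m × (Fin n → ℕ)) := {Z | ∃ g ∈ H, ∃ Y : Fin m × (Fin n → ℕ), W.lm g = Y ∧
    ∃ ν, P.coeff (p g) ν ≠ 0 ∧ Z = (Y.1, Y.2 + ν)}
  have hT : T.Finite := by
    refine (H.finite_toSet.biUnion fun g _ => (Set.finite_univ (α := Fin m)).prod
      ((P.coeff (p g)).support.finite_toSet.image fun ν => W.expo g + ν)).subset ?_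
    rintro _ ⟨g, hg, Y, hY, ν, hν, rfl⟩
    refine Set.mem_biUnion (Finset.mem_coe.2 hg) ⟨Set.mem_univ _, ν, ?_, ?_⟩
    · exact Finsupp.mem_support_iff.2 hν
    · simp [W.expo_eq hY]
  have hne : T.Nonempty := by
    by_contra hT
    refine h0 (Finset.sum_eq_zero fun g hg => ?_)
    by_cases hg0 : g = 0
    · rw [hg0, smul_zero]
    obtain ⟨Y, hY⟩ := W.exists_lm_eq hg0
    have : p g = 0 := by
      refine P.coeff_injective ?_
      ext ν
      rw [coeff_zero]
      by_contra hν
      exact hT ⟨_, g, hg, Y, hY, ν, hν, rfl⟩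
    rw [this, op_zero, zero_smul]
  obtain ⟨_, ⟨g, hg, Y, hY, ν, hν, rfl⟩, hmax⟩ := W.exists_max hT hne
  exact ⟨_, hp g hg Y hY ν hν, p, fun g' hg' Y' hY' ν' hν' =>
    hmax _ ⟨g', hg', Y', hY', ν', hν', rfl⟩, rfl⟩

section Nontrivial

variable [Nontrivial R]

theorem le_of_mem_rep {H : Finset (Fin m → A)} {X Y : Fin m × (Fin n → ℕ)} {f : Fin m → A}
    (hH : ∀ g ∈ H, g ≠ 0) (hf : f ∈ W.rep H {Y | W.le Y X}) (hY : P.coeffAt Y f ≠ 0) :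
    W.le Y X := by
  obtain ⟨p, hp, rfl⟩ := hf
  rw [map_sum] at hY
  obtain ⟨g, hg, hY⟩ := Finset.exists_ne_zero_of_sum_ne_zero hY
  obtain ⟨Z, hZ⟩ := W.exists_lm_eq (hH g hg)
  obtain ⟨ν, hν, hle⟩ := W.exists_of_coeffAt_smul_ne_zero hZ hY
  exact W.trans _ _ _ hle (hp g hg Z hZ ν hν)

theorem term_smul_mem_rep {H : Finset (Fin m → A)} {X : Fin m × (Fin n → ℕ)} {f : Fin m → A}
    (hf : f ∈ W.rep H {Y | W.lt Y X}) (s : R) (δ : Fin n → ℕ) :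
    op (P.ι s * mon P.x δ) • f ∈ W.rep H {Y | W.lt Y (X.1, X.2 + δ)} := by
  obtain ⟨p, hp, rfl⟩ := hf
  rw [Finset.smul_sum]
  refine sum_mem fun g hg => ?_
  rw [smul_smul, ← op_mul]
  refine smul_mem_rep hg fun Y hY ν hν => ?_
  obtain ⟨μ, κ, hμ, hκ, h⟩ := P.exists_of_coeff_mul_ne_zero hν
  obtain rfl := P.eq_of_coeff_term_ne_zero hκ
  refine W.lt_of_le_of_lt ?_ (W.add_right_strictMono (hp g hg Y hY μ hμ) κ)
  rw [add_assoc]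
  rcases h with rfl | h
  · exact W.refl _
  · refine W.deg_compat _ _ ?_
    simp only [deg_add] at h ⊢
    omega

/-- The top terms of a right multiple of a combination with small terms. -/
theorem sum_mul_term_mem_rep {G S : Finset (Fin m → A)} (hSG : S ⊆ G)
    {Y : Fin m × (Fin n → ℕ)} {a : S → Fin n → ℕ} {u : S → R}
    (ha : ∀ g : S, ∃ β, W.lm g.1 = ((Y.1, β) : Fin m × (Fin n → ℕ)) ∧ β + a g = Y.2)
    (hu : ∑ g : S, op (P.ι (u g) * mon P.x (a g)) • g.1 ∈ W.rep G {Z | W.lt Z Y})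
    (s : R) (δ : Fin n → ℕ) :
    ∑ g : S, op (P.ι (u g * P.sigmaPow (a g) s * P.c (a g) δ) * mon P.x (a g + δ)) • g.1 ∈
      W.rep G {Z | W.lt Z (Y.1, Y.2 + δ)} := by
  have hsum : ∑ g : S, op (P.ι (u g) * mon P.x (a g) * (P.ι s * mon P.x δ) -
      P.ι (u g * P.sigmaPow (a g) s * P.c (a g) δ) * mon P.x (a g + δ)) • g.1 ∈
      W.rep G {Z | W.lt Z (Y.1, Y.2 + δ)} := by
    -- Replacing each product of terms by its leading term costs only lower degrees, which lie below
    -- the new bound.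
    refine sum_mem fun g _ => smul_mem_rep (hSG g.2) fun Z hZ ν hν => ?_
    obtain ⟨β, hβ, hY⟩ := ha g
    rw [hZ, WithBot.coe_inj] at hβ
    subst hβ
    have := P.term_mul_term (u g) s (a g) δ ν hν
    refine W.lt_of_deg_lt ?_
    rw [← hY]
    simp only [deg_add]
    omega
  have h := sub_mem (term_smul_mem_rep hu s δ) hsum
  rw [Finset.smul_sum, ← Finset.sum_sub_distrib] at h
  convert h using 2 with g
  rw [smul_smul, ← op_mul, ← sub_smul, ← op_sub, sub_sub_cancel]

/-! ### Lifting syzygies and Buchberger's criterion. -/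

variable (W) in
/-- For some generating set of the syzygies of `S`, all S-vectors are combinations of elements
of `H` with terms below `X_S`. -/
def SyzRep (H S : Finset (Fin m → A)) : Prop :=
  ∀ X, W.IsLcm S X → ∃ B : Set (S → R), Submodule.span Rᵐᵒᵖ B = W.syzModule S X ∧
    ∀ b ∈ B, W.sVector S X b ∈ W.rep H {Y | W.lt Y X}

omit [Nontrivial R] in
theorem SyzRep.mono {H H' S : Finset (Fin m → A)} (h : W.SyzRep H S) (hH : H ⊆ H') :
    W.SyzRep H' S := fun X hX =>
  let ⟨B, hB, hrep⟩ := h X hX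
  ⟨B, hB, fun b hb => rep_mono hH subset_rfl (hrep b hb)⟩

omit [Nontrivial R] in
theorem IsLcm.expo_le {S : Finset (Fin m → A)} {X : Fin m × (Fin n → ℕ)} (hX : W.IsLcm S X)
    {g : Fin m → A} (hg : g ∈ S) : W.expo g ≤ X.2 :=
  hX.2.2 ▸ Finset.le_sup hg

/-- Passes from the S-vectors of a generating set to every syzygy and every multiple x^δ of the
least common multiple. The first conclusion fixes the lift's coefficients, since the left side is
injective in r. -/
theorem exists_lift_of_mem_syzModule {G S : Finset (Fin m → A)} (hSG : S ⊆ G)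
    {X : Fin m × (Fin n → ℕ)} (hX : W.IsLcm S X) (h : W.SyzRep G S) (δ : Fin n → ℕ)
    {b : S → R} (hb : b ∈ W.syzModule S X) :
    ∃ r : S → R,
      (∀ g : S, P.sigmaPow (W.expo g.1) (r g) * P.c (W.expo g.1) (X.2 - W.expo g.1 + δ) =
        P.c (W.expo g.1) (X.2 - W.expo g.1) * b g) ∧
      ∑ g : S, op (P.ι (r g) * mon P.x (X.2 - W.expo g.1 + δ)) • g.1 ∈
        W.rep G {Y | W.lt Y (X.1, X.2 + δ)} := by
  obtain ⟨B, hB, hrep⟩ := h X hX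
  have hexp : ∀ g : S, W.expo g.1 + (X.2 - W.expo g.1) = X.2 := fun g =>
    add_tsub_cancel_of_le (hX.expo_le g.2)
  rw [← hB] at hb
  induction hb using Submodule.span_induction with
  | mem b hb =>
    -- The S-vector is multiplied by s x^δ, with s chosen to cancel the factor c_{X,δ} that the
    -- multiplication creates.
    obtain ⟨s, hs⟩ := P.exists_sigmaPow_mul_c X.2 δ 1
    refine ⟨_, fun g => ?_, sum_mul_term_mem_rep hSG
      (fun g => ⟨_, hX.2.1 g.1 g.2, hexp g⟩) (hrep b hb) s δ⟩
    rw [symbol_assoc, sigmaPow_psi_inv_mul_c, hexp, mul_assoc _ _ (P.c _ _), hs, mul_one]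
  | zero => exact ⟨0, by simp [sigmaPow_map_zero], by simp⟩
  | add b b' _ _ ih ih' =>
    obtain ⟨r, hr, hmem⟩ := ih
    obtain ⟨r', hr', hmem'⟩ := ih'
    refine ⟨r + r', fun g => ?_, ?_⟩
    · rw [Pi.add_apply, sigmaPow_add, add_mul, hr, hr', Pi.add_apply, mul_add]
    · simpa [add_mul, add_smul, Finset.sum_add_distrib] using add_mem hmem hmem'
  | smul t b _ ih =>
    obtain ⟨r, hr, hmem⟩ := ih
    -- A constant multiplied on the right passes x^{X+δ} as its image under σ^{X+δ}, so a preimage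
    -- of t is needed.
    obtain ⟨s, hs⟩ := (P.sigmaPow (X.2 + δ)).surjective t.unop
    have := sum_mul_term_mem_rep (Y := (X.1, X.2 + δ)) hSG
      (fun g => ⟨_, hX.2.1 g.1 g.2, by rw [← add_assoc, hexp]⟩) hmem s 0
    simp only [add_zero] at this
    refine ⟨_, fun g => ?_, this⟩
    have hassoc := P.symbol_assoc (W.expo g.1) (X.2 - W.expo g.1 + δ) 0 (r g) s
    rw [add_zero] at hassoc
    rw [hassoc, hr, ← add_assoc, hexp, hs, c_zero_right, mul_one, mul_assoc]
    rfl

open Classical in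
variable (W) in
/-- The elements of `G` whose leading monomials divide `X`. -/
noncomputable def divisors (G : Finset (Fin m → A)) (X : Fin m × (Fin n → ℕ)) :
    Finset (Fin m → A) :=
  G.filter fun g => W.lm g = ((X.1, W.expo g) : Fin m × (Fin n → ℕ)) ∧ W.expo g ≤ X.2

omit [Nontrivial R] in
theorem mem_divisors {G : Finset (Fin m → A)} {X : Fin m × (Fin n → ℕ)} {g : Fin m → A} :
    g ∈ W.divisors G X ↔
      g ∈ G ∧ W.lm g = ((X.1, W.expo g) : Fin m × (Fin n → ℕ)) ∧ W.expo g ≤ X.2 := by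
  simp [divisors]

omit [Nontrivial R] in
theorem mem_divisors_of_eq {G : Finset (Fin m → A)} {X Y : Fin m × (Fin n → ℕ)} {g : Fin m → A}
    {ν : Fin n → ℕ} (hg : g ∈ G) (hY : W.lm g = Y) (h : (Y.1, Y.2 + ν) = X) :
    g ∈ W.divisors G X ∧ ν = X.2 - W.expo g := by
  subst h
  rw [mem_divisors, W.expo_eq hY]
  exact ⟨⟨hg, hY, le_self_add⟩, by simp⟩

theorem coeffAt_sum_smul {G : Finset (Fin m → A)} (hG : ∀ g ∈ G, g ≠ 0)
    {X : Fin m × (Fin n → ℕ)} {p : (Fin m → A) → A}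
    (hp : ∀ g ∈ G, ∀ Y : Fin m × (Fin n → ℕ), W.lm g = Y → ∀ ν, P.coeff (p g) ν ≠ 0 →
      W.le (Y.1, Y.2 + ν) X) :
    P.coeffAt X (∑ g ∈ G, op (p g) • g) = ∑ g ∈ W.divisors G X,
      W.lc g * P.sigmaPow (W.expo g) (P.coeff (p g) (X.2 - W.expo g)) *
        P.c (W.expo g) (X.2 - W.expo g) := by
  classical
  rw [map_sum, ← Finset.sum_subset (s₁ := W.divisors G X) (fun g hg => (mem_divisors.1 hg).1)]
  · refine Finset.sum_congr rfl fun g hg => ?_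
    obtain ⟨hgG, hlm, hle⟩ := mem_divisors.1 hg
    have hX : (X.1, W.expo g + (X.2 - W.expo g)) = X := by rw [add_tsub_cancel_of_le hle]
    have := W.coeffAt_smul_eq hlm (p := p g) (α := X.2 - W.expo g)
      fun ν hν => by simpa only [hX] using hp g hgG _ hlm ν hν
    simpa only [hX] using this
  · intro g hgG hg
    by_contra h0
    obtain ⟨Y, hY⟩ := W.exists_lm_eq (hG g hgG)
    obtain ⟨ν, hν, hle⟩ := W.exists_of_coeffAt_smul_ne_zero hY h0
    exact hg (mem_divisors_of_eq hgG hY (W.antisymm _ _ (hp g hgG Y hY ν hν) hle)).1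

/-- Split the sum into its terms at X and the rest. The terms at X carry a syzygy of the divisors of
X, and its lift is this very part of the sum. -/
theorem mem_rep_lt_of_coeffAt_eq_zero {G : Finset (Fin m → A)} (hG : ∀ g ∈ G, g ≠ 0)
    (hsyz : ∀ S ⊆ G, W.SyzRep G S) {X : Fin m × (Fin n → ℕ)} {f : Fin m → A}
    (hf : f ∈ W.rep G {Y | W.le Y X}) (h0 : P.coeffAt X f = 0) :
    f ∈ W.rep G {Y | W.lt Y X} := by
  classical
  obtain ⟨p, hp, rfl⟩ := hf
  rw [coeffAt_sum_smul hG hp] at h0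
  set S := W.divisors G X with hS
  have hSG : S ⊆ G := fun g hg => (mem_divisors.1 hg).1
  have htop : ∑ g ∈ S, op (P.ι (P.coeff (p g) (X.2 - W.expo g)) *
      mon P.x (X.2 - W.expo g)) • g ∈ W.rep G {Y | W.lt Y X} := by
    rcases S.eq_empty_or_nonempty with he | hne
    · rw [he, Finset.sum_empty]
      exact zero_mem _
    set Z : Fin m × (Fin n → ℕ) := (X.1, S.sup W.expo) with hZdef
    have hZ : W.IsLcm S Z := ⟨hne, fun g hg => (mem_divisors.1 hg).2.1, rfl⟩
    have hZX : Z.2 ≤ X.2 := Finset.sup_le fun g hg => (mem_divisors.1 hg).2.2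
    have hα : ∀ g : S, Z.2 - W.expo g.1 + (X.2 - Z.2) = X.2 - W.expo g.1 := fun g => by
      rw [add_comm, tsub_add_tsub_cancel hZX (hZ.expo_le g.2)]
    -- The cancellation takes place at X but syzygies are formed at the least common multiple Z; the
    -- unit c_{β,γ} is divided out on the left.
    have hb : ∀ g : S, ∃ b, P.c (W.expo g.1) (Z.2 - W.expo g.1) * b =
        P.sigmaPow (W.expo g.1) (P.coeff (p g.1) (X.2 - W.expo g.1)) *
          P.c (W.expo g.1) (X.2 - W.expo g.1) := fun g => by
      obtain ⟨u, hu⟩ := P.isUnit_c (W.expo g.1) (Z.2 - W.expo g.1)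
      exact ⟨↑u⁻¹ * _, by rw [← hu, ← mul_assoc, Units.mul_inv, one_mul]⟩
    choose b hb using hb
    have hbmem : b ∈ W.syzModule S Z := by
      change ∑ g : S, _ = (0 : R)
      rw [← h0, ← Finset.sum_coe_sort S]
      exact Finset.sum_congr rfl fun g _ => by rw [mul_assoc, hb, mul_assoc]
    obtain ⟨r, hr, hmem⟩ := exists_lift_of_mem_syzModule hSG hZ (hsyz S hSG) (X.2 - Z.2) hbmem
    have hXZ : (Z.1, Z.2 + (X.2 - Z.2)) = X := by rw [add_tsub_cancel_of_le hZX]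
    rw [hXZ] at hmem
    rw [← Finset.sum_coe_sort S]
    convert hmem using 2 with g
    rw [hα]
    -- The lift has the same twisted coefficients as the top terms of the p_g, hence the same
    -- coefficients.
    have := P.sigmaPow_mul_c_injective _ _ ((hr g).trans (hb g) |>.trans (by rw [hα]))
    rw [this]
  have hrest : ∑ g ∈ G, op (p g) • g - ∑ g ∈ S, op (P.ι (P.coeff (p g) (X.2 - W.expo g)) *
      mon P.x (X.2 - W.expo g)) • g ∈ W.rep G {Y | W.lt Y X} := by
    rw [← Finset.inter_eq_right.2 hSG, ← Finset.sum_ite_mem, ← Finset.sum_sub_distrib]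
    refine sum_mem fun g hg => ?_
    split_ifs with hgS
    · rw [← sub_smul, ← op_sub]
      refine smul_mem_rep hg fun Y hY ν hν => ⟨?_, fun he => hν ?_⟩
      · by_cases he : (Y.1, Y.2 + ν) = X
        · exact he ▸ W.refl _
        refine hp g hg Y hY ν fun h => hν ?_
        rw [coeff_sub, coeff_ι_mul_mon, Finsupp.sub_apply, h, Finsupp.single_eq_of_ne, sub_zero]
        rintro rfl
        refine he ?_
        rw [← W.expo_eq hY, add_tsub_cancel_of_le (mem_divisors.1 hgS).2.2]
        have := (mem_divisors.1 hgS).2.1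
        rw [hY, WithBot.coe_inj] at this
        rw [this]
      · rw [← (mem_divisors_of_eq hg hY he).2, coeff_sub, coeff_ι_mul_mon, Finsupp.sub_apply,
          Finsupp.single_eq_same, sub_self]
    · rw [sub_zero]
      exact smul_mem_rep hg fun Y hY ν hν =>
        ⟨hp g hg Y hY ν hν, fun he => hgS (mem_divisors_of_eq hg hY he).1⟩
  simpa using add_mem hrest htop

-- Frees the sums from the index type `Fin t` that `Red` prescribes.
omit [Nontrivial R] in
theorem exists_red_of_sum {F : Finset (Fin m → A)} {f : Fin m → A} {X : Fin m × (Fin n → ℕ)}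
    (hX : W.lm f = X) {κ : Type*} [Fintype κ] (g : κ → Fin m → A) (r : κ → R)
    (α : κ → Fin n → ℕ) (hg : ∀ k, g k ∈ F)
    (hα : ∀ k, ∃ β : Fin n → ℕ,
      W.lm (g k) = ((X.1, β) : Fin m × (Fin n → ℕ)) ∧ β + α k = X.2)
    (hlc : W.lc f =
      ∑ k, W.lc (g k) * P.sigmaPow (W.expo (g k)) (r k) * P.c (W.expo (g k)) (α k)) :
    ∃ h, W.Red F f h := by
  let e := (Fintype.equivFin κ).symm
  refine ⟨_, X, hX, Fintype.card κ, g ∘ e, r ∘ e, α ∘ e, fun i => hg _, fun i => hα _, ?_, rfl⟩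
  rw [hlc, ← e.sum_comp]
  rfl

/-- Buchberger's criterion. -/
theorem exists_red_of_mem_span {G : Finset (Fin m → A)} (hG : ∀ g ∈ G, g ≠ 0)
    (hsyz : ∀ S ⊆ G, W.SyzRep G S) {f : Fin m → A}
    (hf : f ∈ Submodule.span Aᵐᵒᵖ (G : Set (Fin m → A))) (h0 : f ≠ 0) :
    ∃ h, W.Red G f h := by
  obtain ⟨X, -, hX⟩ := exists_mem_rep_le (W := W) (mem_rep_univ hf) h0
  induction X using W.wellFounded_lt.induction with
  | _ X ih =>
    by_cases hc : P.coeffAt X f = 0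
    -- The terms at X cancel, so f has a representation bounded by a smaller Y.
    · obtain ⟨Y, hY, hfY⟩ := exists_mem_rep_le (mem_rep_lt_of_coeffAt_eq_zero hG hsyz hX hc) h0
      exact ih Y hY hfY
    have hlm : W.lm f = X := W.lm_eq_iff.2 ⟨hc, fun Y hY => le_of_mem_rep hG hX hY⟩
    obtain ⟨p, hp, rfl⟩ := hX
    refine exists_red_of_sum hlm (κ := W.divisors G X) (fun g => g.1)
      (fun g => P.coeff (p g.1) (X.2 - W.expo g.1)) (fun g => X.2 - W.expo g.1)
      (fun g => (mem_divisors.1 g.2).1) (fun g => ⟨_, (mem_divisors.1 g.2).2.1,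
        add_tsub_cancel_of_le (mem_divisors.1 g.2).2.2⟩) ?_
    rw [W.lc_eq hlm, coeffAt_sum_smul hG hp, ← Finset.sum_coe_sort (W.divisors G X)]

end Nontrivial

end VecMonOrder

end SkewPBW

namespace SkewPBW

open MulOpposite

namespace VecMonOrder

open BijSkewPBWExt SkewPBWExt

variable {R A : Type*} [Ring R] [Ring A] {n m : ℕ} {P : BijSkewPBWExt R A n} {O : MonOrder P}
  {W : VecMonOrder P O m}

/-! ### One-step reductions and S-vectors. -/

section Terms

variable {κ : Type*} [Fintype κ] {g : κ → Fin m → A} {X : Fin m × (Fin n → ℕ)}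
  {α : κ → Fin n → ℕ}

theorem sum_term_mem_rep {F : Finset (Fin m → A)} (hgF : ∀ k, g k ∈ F)
    (hg : ∀ k, ∃ β : Fin n → ℕ, W.lm (g k) = ((X.1, β) : Fin m × (Fin n → ℕ)) ∧ β + α k = X.2)
    (r : κ → R) :
    ∑ k, op (P.ι (r k) * mon P.x (α k)) • g k ∈ W.rep F {Y | W.le Y X} := by
  refine sum_mem fun k _ => smul_mem_rep (hgF k) fun Y hY ν hν => ?_
  obtain ⟨β, hβ, hX⟩ := hg k
  rw [hY, WithBot.coe_inj] at hβ
  subst hβ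
  rw [P.eq_of_coeff_term_ne_zero hν, hX]
  exact W.refl _

variable [Nontrivial R]

theorem coeffAt_sum_term
    (hg : ∀ k, ∃ β : Fin n → ℕ, W.lm (g k) = ((X.1, β) : Fin m × (Fin n → ℕ)) ∧ β + α k = X.2)
    (r : κ → R) :
    P.coeffAt X (∑ k, op (P.ι (r k) * mon P.x (α k)) • g k) =
      ∑ k, W.lc (g k) * P.sigmaPow (W.expo (g k)) (r k) * P.c (W.expo (g k)) (α k) := by
  rw [map_sum]
  refine Finset.sum_congr rfl fun k _ => ?_
  obtain ⟨β, hβ, hX⟩ := hg k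
  have hXe : (X.1, β + α k) = X := by rw [hX]
  have := W.coeffAt_smul_eq hβ (p := P.ι (r k) * mon P.x (α k)) (α := α k) fun ν hν => by
    rw [P.eq_of_coeff_term_ne_zero hν]
    exact W.refl _
  rw [coeff_ι_mul_mon, Finsupp.single_eq_same, hXe] at this
  rw [W.expo_eq hβ]
  exact this

theorem le_of_coeffAt_sum_term_ne_zero
    (hg : ∀ k, ∃ β : Fin n → ℕ, W.lm (g k) = ((X.1, β) : Fin m × (Fin n → ℕ)) ∧ β + α k = X.2)
    {r : κ → R} {Y : Fin m × (Fin n → ℕ)}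
    (hY : P.coeffAt Y (∑ k, op (P.ι (r k) * mon P.x (α k)) • g k) ≠ 0) : W.le Y X := by
  rw [map_sum] at hY
  obtain ⟨k, -, hY⟩ := Finset.exists_ne_zero_of_sum_ne_zero hY
  obtain ⟨β, hβ, hX⟩ := hg k
  obtain ⟨ν, hν, hle⟩ := W.exists_of_coeffAt_smul_ne_zero hβ hY
  rwa [P.eq_of_coeff_term_ne_zero hν, hX] at hle

end Terms

theorem Red.sub_mem_rep {F : Finset (Fin m → A)} {f h : Fin m → A} (hr : W.Red F f h)
    {X : Fin m × (Fin n → ℕ)} (hf : ∀ Y, P.coeffAt Y f ≠ 0 → W.lt Y X) :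
    f - h ∈ W.rep F {Y | W.lt Y X} := by
  obtain ⟨Z, hZ, t, g, r, α, hgF, hg, -, rfl⟩ := hr
  rw [sub_sub_cancel]
  exact rep_mono subset_rfl (fun Y hY => W.lt_of_le_of_lt hY (hf Z (W.coeffAt_lm_ne_zero hZ)))
    (sum_term_mem_rep hgF hg r)

theorem Red.lm_ne_bot {F : Finset (Fin m → A)} {f h : Fin m → A} (hr : W.Red F f h) :
    ∃ X : Fin m × (Fin n → ℕ), W.lm f = X := hr.imp fun _ h => h.1

variable [Nontrivial R]

theorem Red.lt_lm {F : Finset (Fin m → A)} {f h : Fin m → A} (hr : W.Red F f h)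
    {X Y : Fin m × (Fin n → ℕ)} (hX : W.lm f = X) (hY : P.coeffAt Y h ≠ 0) : W.lt Y X := by
  obtain ⟨Z, hZ, t, g, r, α, hgF, hg, hlc, rfl⟩ := hr
  rw [hX, WithBot.coe_inj] at hZ
  subst hZ
  refine ⟨?_, ?_⟩
  · by_cases hf : P.coeffAt Y f = 0
    · rw [map_sub, hf, zero_sub, neg_ne_zero] at hY
      exact le_of_coeffAt_sum_term_ne_zero hg hY
    · exact W.le_lm hX hf
  · rintro rfl
    rw [map_sub, coeffAt_sum_term hg, ← hlc, W.lc_eq hX, sub_self] at hY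
    exact hY rfl

theorem lt_of_coeffAt_sVector_ne_zero {S : Finset (Fin m → A)} {X Y : Fin m × (Fin n → ℕ)}
    (hX : W.IsLcm S X) {b : S → R} (hb : b ∈ W.syzModule S X)
    (hY : P.coeffAt Y (W.sVector S X b) ≠ 0) : W.lt Y X := by
  have hg : ∀ g : S, ∃ β : Fin n → ℕ,
      W.lm g.1 = ((X.1, β) : Fin m × (Fin n → ℕ)) ∧ β + (X.2 - W.expo g.1) = X.2 :=
    fun g => ⟨_, hX.2.1 g.1 g.2, add_tsub_cancel_of_le (hX.expo_le g.2)⟩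
  refine ⟨le_of_coeffAt_sum_term_ne_zero hg hY, ?_⟩
  rintro rfl
  refine hY ((coeffAt_sum_term hg _).trans ?_)
  have hb0 : ∑ g : S, W.lc g.1 * P.c (W.expo g.1) (Y.2 - W.expo g.1) * b g = 0 := hb
  rw [← hb0]
  refine Finset.sum_congr rfl fun g _ => ?_
  rw [mul_assoc, sigmaPow_psi_inv_mul_c, mul_assoc]

omit [Nontrivial R] in
theorem sVector_mem_span {S H : Finset (Fin m → A)} (hS : S ⊆ H) (X : Fin m × (Fin n → ℕ))
    (b : S → R) : W.sVector S X b ∈ Submodule.span Aᵐᵒᵖ (H : Set (Fin m → A)) :=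
  sum_mem fun g _ => Submodule.smul_mem _ _ (Submodule.subset_span (hS g.2))

/-! ### Only finitely many reduced vectors can be adjoined. -/

open Classical in
variable (W) in
/-- `H'` arises from `H` by adjoining a nonzero reduced vector. -/
def Adjoins (H H' : Finset (Fin m → A)) : Prop :=
  ∃ r, W.Reduced H r ∧ r ≠ 0 ∧ H' = insert r H

section Noetherian

omit [Nontrivial R]

variable [IsNoetherian Rᵐᵒᵖ R]

theorem exists_finset_span_eq_syzModule (S : Finset (Fin m → A)) (X : Fin m × (Fin n → ℕ)) :
    ∃ B : Finset (S → R), Submodule.span Rᵐᵒᵖ (B : Set (S → R)) = W.syzModule S X :=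
  IsNoetherian.noetherian (W.syzModule S X)

/-- In a sequence of terms over a Noetherian ring, some coefficient lies in the right ideal
generated by the coefficients of the earlier terms dividing it. -/
theorem exists_mem_span_earlier (a : ℕ → R) (X : ℕ → Fin m × (Fin n → ℕ)) :
    ∃ (N k : ℕ) (φ : Fin k → ℕ), (∀ j, φ j < N ∧ (X (φ j)).1 = (X N).1 ∧ (X (φ j)).2 ≤ (X N).2) ∧
      a N ∈ Submodule.span Rᵐᵒᵖ (Set.range fun j => a (φ j)) := by
  have hwqo : WellQuasiOrdered fun Y Z : Fin m × (Fin n → ℕ) => Y.1 = Z.1 ∧ Y.2 ≤ Z.2 :=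
    (Finite.wellQuasiOrdered (· = ·)).prod wellQuasiOrdered_le
  have : IsPreorder (Fin m × (Fin n → ℕ)) fun Y Z => Y.1 = Z.1 ∧ Y.2 ≤ Z.2 :=
    { refl := fun _ => ⟨rfl, le_rfl⟩
      trans := fun _ _ _ h h' => ⟨h.1.trans h'.1, h.2.trans h'.2⟩ }
  obtain ⟨φ, hφ⟩ := hwqo.exists_monotone_subseq X
  let I : ℕ →o Submodule Rᵐᵒᵖ R :=
    { toFun := fun k => Submodule.span Rᵐᵒᵖ (Set.range fun j : Fin k => a (φ j))
      monotone' := fun k l hkl => Submodule.span_mono <| by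
        rintro _ ⟨j, rfl⟩
        exact ⟨⟨j, j.2.trans_le hkl⟩, rfl⟩ }
  -- Dickson's lemma has given a subsequence along which the monomials divide one another; once its
  -- ideals are stationary, the next coefficient is already in the ideal.
  obtain ⟨k, hk⟩ := monotone_stabilizes_iff_noetherian.2 ‹IsNoetherian Rᵐᵒᵖ R› I
  refine ⟨φ k, k, fun j => φ j, fun j => ⟨φ.strictMono j.2, hφ _ _ j.2.le⟩, ?_⟩
  have : a (φ k) ∈ I (k + 1) := Submodule.subset_span ⟨Fin.last k, rfl⟩
  rwa [← hk (k + 1) (Nat.le_succ k)] at this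

/-- Adjoining nonzero reduced vectors comes to an end. -/
theorem wellFounded_adjoins : WellFounded (flip W.Adjoins) := by
  classical
  rw [wellFounded_iff_isEmpty_descending_chain]
  refine ⟨fun ⟨H, hH⟩ => ?_⟩
  choose r hr hr0 hins using hH
  choose X hX using fun k => W.exists_lm_eq (hr0 k)
  have hmono : Monotone H := monotone_nat_of_le_succ fun k => by
    rw [hins]
    exact Finset.subset_insert _ _
  obtain ⟨N, k, φ, hφ, hmem⟩ := exists_mem_span_earlier (fun k => W.lc (r k)) X
  obtain ⟨t, ht⟩ := (Submodule.mem_span_range_iff_exists_fun _).1 hmem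
  choose s hs using fun j => P.exists_sigmaPow_mul_c (W.expo (r (φ j)))
    ((X N).2 - (X (φ j)).2) (t j).unop
  -- The vectors adjoined earlier reduce the N-th one, although it was adjoined as a nonzero reduced
  -- vector.
  refine (hr N).elim (hr0 N) fun h => h ?_
  refine exists_red_of_sum (hX N) (fun j => r (φ j)) s (fun j => (X N).2 - (X (φ j)).2)
    (fun j => hmono (Nat.succ_le_of_lt (hφ j).1) (by rw [hins]; exact Finset.mem_insert_self _ _))
    (fun j => ⟨(X (φ j)).2, ?_, add_tsub_cancel_of_le (hφ j).2.2⟩) ?_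
  · rw [hX, ← (hφ j).2.1]
  · rw [← ht]
    refine Finset.sum_congr rfl fun j _ => ?_
    rw [mul_assoc, hs]
    rfl

end Noetherian

end VecMonOrder

/-! ### Executions: progress and termination. -/

section Algorithm

open VecMonOrder BijSkewPBWExt SkewPBWExt

variable {R A : Type*} [Ring R] [Ring A] {n m : ℕ} {P : BijSkewPBWExt R A n} {O : MonOrder P}
  {W : VecMonOrder P O m}

theorem exists_step_or_eq_done [IsNoetherian Rᵐᵒᵖ R] (s : Config R A n m) :
    (∃ s', Step W s s') ∨ ∃ G, s = .done G := by
  classical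
  cases s with
  | test G H =>
    by_cases h : H = G
    · subst h
      exact .inl ⟨_, .finish H⟩
    · exact .inl ⟨_, .enter G H h⟩
  | subsets G H D =>
    left
    rcases D.eq_empty_or_nonempty with rfl | ⟨S, hS⟩
    · exact ⟨_, .subsetsEnd G H⟩
    by_cases hX : ∃ X, W.IsLcm S X
    · obtain ⟨X, hX⟩ := hX
      obtain ⟨B, hB⟩ := exists_finset_span_eq_syzModule (W := W) S X
      exact ⟨_, .compute G H D S X B hS hX hB⟩
    · exact ⟨_, .skip G H D S hS hX⟩
  | syzygies G H D S X B =>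
    left
    rcases B.eq_empty_or_nonempty with rfl | ⟨b, hb⟩
    · exact ⟨_, .syzygiesEnd G H D S X⟩
    · exact ⟨_, .form G H D S X B b hb⟩
  | reduce G H D S X B h =>
    left
    by_cases h0 : h = 0
    · subst h0
      exact ⟨_, .discard G H D S X B⟩
    by_cases hr : W.Reduced H h
    · exact ⟨_, .adjoin G H D S X B h hr h0⟩
    · obtain ⟨k, hk⟩ := not_not.1 (not_or.1 hr).2
      exact ⟨_, .red G H D S X B h k hr hk⟩
  | done G => exact .inr ⟨G, rfl⟩

section Termination

variable [Nontrivial R]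

/-- Each reduction lowers the leading monomial. The bound Z in `key` stands in for that monomial, as
the current vector may be 0. -/
theorem acc_reduce {G H : Finset (Fin m → A)} {D : Finset (Finset (Fin m → A))}
    {S : Finset (Fin m → A)} {X : Fin m × (Fin n → ℕ)} {B : Finset (S → R)}
    (hsyz : Acc (flip (Step W)) (.syzygies G H D S X B))
    (hadj : ∀ H', W.Adjoins H H' → Acc (flip (Step W)) (.syzygies G H' D S X B))
    (h : Fin m → A) :
    Acc (flip (Step W)) (.reduce G H D S X B h) := by
  have key : ∀ Z, ∀ h : Fin m → A, (∀ Y, P.coeffAt Y h ≠ 0 → W.lt Y Z) →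
      Acc (flip (Step W)) (.reduce G H D S X B h) := by
    intro Z
    induction Z using W.wellFounded_lt.induction with
    | _ Z ih =>
      refine fun h hZ => ⟨_, fun s hs => ?_⟩
      cases hs with
      | red _ _ _ _ _ _ _ k _ hk =>
        obtain ⟨Y, hY⟩ := hk.lm_ne_bot
        exact ih Y (hZ Y (W.coeffAt_lm_ne_zero hY)) k fun Y' hY' => hk.lt_lm hY hY'
      | discard => exact hsyz
      | adjoin _ _ _ _ _ _ _ hr h0 => exact hadj _ ⟨_, hr, h0, rfl⟩
  refine ⟨_, fun s hs => ?_⟩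
  cases hs with
  | red _ _ _ _ _ _ _ k _ hk =>
    obtain ⟨Y, hY⟩ := hk.lm_ne_bot
    exact key Y k fun Y' hY' => hk.lt_lm hY hY'
  | discard => exact hsyz
  | adjoin _ _ _ _ _ _ _ hr h0 => exact hadj _ ⟨_, hr, h0, rfl⟩

/-- While H is unchanged, first |B| and then |D| decrease. An adjunction leaves this descent and is
handed to `hadj`, which is therefore required for all D, S, X and B. -/
theorem acc_subsets {G H : Finset (Fin m → A)} (htest : Acc (flip (Step W)) (.test G H))
    (hadj : ∀ H', W.Adjoins H H' → ∀ D (S : Finset (Fin m → A)) X (B : Finset (S → R)),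
      Acc (flip (Step W)) (.syzygies G H' D S X B))
    (D : Finset (Finset (Fin m → A))) :
    Acc (flip (Step W)) (.subsets G H D) ∧
      ∀ (S : Finset (Fin m → A)) X (B : Finset (S → R)),
        Acc (flip (Step W)) (.syzygies G H D S X B) := by
  classical
  induction hD : D.card using Nat.strong_induction_on generalizing D with
  | _ d ih =>
    have hsub : Acc (flip (Step W)) (.subsets G H D) := by
      refine ⟨_, fun s hs => ?_⟩
      cases hs with
      | subsetsEnd => exact htest
      | skip _ _ _ S hS _ => exact (ih _ (hD ▸ Finset.card_erase_lt_of_mem hS) _ rfl).1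
      | compute _ _ _ S X B hS _ _ =>
        exact (ih _ (hD ▸ Finset.card_erase_lt_of_mem hS) _ rfl).2 S X B
    refine ⟨hsub, fun S X B => ?_⟩
    induction hB : B.card using Nat.strong_induction_on generalizing B with
    | _ e ihB =>
      refine ⟨_, fun s hs => ?_⟩
      cases hs with
      | syzygiesEnd => exact hsub
      | form _ _ _ _ _ _ b hb =>
        exact acc_reduce (ihB _ (hB ▸ Finset.card_erase_lt_of_mem hb) _ rfl)
          (fun H' hH' => hadj H' hH' _ _ _ _) _

/-- Every execution of the algorithm is finite. -/
theorem acc_step [IsNoetherian Rᵐᵒᵖ R] (H : Finset (Fin m → A)) :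
    (∀ G, Acc (flip (Step W)) (.test G H)) ∧
      ∀ G D (S : Finset (Fin m → A)) X (B : Finset (S → R)),
        Acc (flip (Step W)) (.syzygies G H D S X B) := by
  classical
  induction H using (wellFounded_adjoins (W := W)).induction with
  | _ H ih =>
    have hdone : ∀ G, Acc (flip (Step W)) (.done G : Config R A n m) :=
      fun G => ⟨_, fun s hs => by cases hs⟩
    have hself : Acc (flip (Step W)) (.test H H) := by
      refine ⟨_, fun s hs => ?_⟩
      cases hs with
      | finish => exact hdone H
      | enter _ _ hne => exact absurd rfl hne
    have htest : ∀ G, Acc (flip (Step W)) (.test G H) := by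
      refine fun G => ⟨_, fun s hs => ?_⟩
      cases hs with
      | finish => exact hdone H
      -- On entry G becomes H, so a pass without adjunction returns to a test of H against itself,
      -- which can only finish.
      | enter => exact (acc_subsets hself (fun H' hH' => (ih H' hH').2 H) _).1
    exact ⟨htest, fun G D => (acc_subsets (htest G) (fun H' hH' => (ih H' hH').2 G) D).2⟩

end Termination

/-! ### Correctness: the loop invariant. -/

section Correctness

/-- `H` consists of nonzero vectors and generates the same right submodule as `F ⊆ H`. -/
structure Extends (F H : Finset (Fin m → A)) : Prop where
  subset : F ⊆ H
  ne_zero : ∀ g ∈ H, g ≠ 0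
  mem_span : ∀ g ∈ H, g ∈ Submodule.span Aᵐᵒᵖ (F : Set (Fin m → A))

theorem Extends.span_eq {F H : Finset (Fin m → A)} (h : Extends F H) :
    Submodule.span Aᵐᵒᵖ (H : Set (Fin m → A)) = Submodule.span Aᵐᵒᵖ (F : Set (Fin m → A)) :=
  le_antisymm (Submodule.span_le.2 h.mem_span) (Submodule.span_mono (Finset.coe_subset.2 h.subset))

variable (W) in
/-- The invariant of the algorithm with input `F`. -/
def Invariant (F : Finset (Fin m → A)) : Config R A n m → Prop
  | .test G H => Extends F H ∧ G ⊆ H ∧ ∀ S ⊆ G, W.SyzRep H S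
  | .subsets G H D => Extends F H ∧ G ⊆ H ∧ (∀ S ∈ D, S ⊆ H) ∧ ∀ S ⊆ G, S ∉ D → W.SyzRep H S
  | .syzygies G H D S X B => Extends F H ∧ G ⊆ H ∧ (∀ S ∈ D, S ⊆ H) ∧
      (∀ S' ⊆ G, S' ∉ D → S' ≠ S → W.SyzRep H S') ∧ S ⊆ H ∧ W.IsLcm S X ∧
      -- B₀ remembers the whole generating set chosen for S, of which B is the untreated part.
      ∃ B₀ : Set (S → R), Submodule.span Rᵐᵒᵖ B₀ = W.syzModule S X ∧ (∀ b ∈ B, b ∈ B₀) ∧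
        ∀ b ∈ B₀, b ∉ B → W.sVector S X b ∈ W.rep H {Y | W.lt Y X}
  | .reduce G H D S X B h => Extends F H ∧ G ⊆ H ∧ (∀ S ∈ D, S ⊆ H) ∧
      (∀ S' ⊆ G, S' ∉ D → S' ≠ S → W.SyzRep H S') ∧ S ⊆ H ∧ W.IsLcm S X ∧
      ∃ B₀ : Set (S → R), Submodule.span Rᵐᵒᵖ B₀ = W.syzModule S X ∧ (∀ b ∈ B, b ∈ B₀) ∧
        ∃ b₀, (∀ b ∈ B₀, b ∉ B → b ≠ b₀ → W.sVector S X b ∈ W.rep H {Y | W.lt Y X}) ∧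
          W.sVector S X b₀ - h ∈ W.rep H {Y | W.lt Y X} ∧
          ∀ Y, P.coeffAt Y h ≠ 0 → W.lt Y X
  | .done G => Extends F G ∧ ∀ S ⊆ G, W.SyzRep G S

theorem isLcm_unique {S : Finset (Fin m → A)} {X Y : Fin m × (Fin n → ℕ)} (hX : W.IsLcm S X)
    (hY : W.IsLcm S Y) : X = Y := by
  obtain ⟨g, hg⟩ := hX.1
  have := (hX.2.1 g hg).symm.trans (hY.2.1 g hg)
  rw [WithBot.coe_inj, Prod.mk.injEq] at this
  exact Prod.ext this.1 (hX.2.2.trans hY.2.2.symm)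

theorem Invariant.step [Nontrivial R] {F : Finset (Fin m → A)} {s s' : Config R A n m}
    (h : Invariant W F s) (hs : Step W s s') : Invariant W F s' := by
  classical
  cases hs with
  | finish G => exact ⟨h.1, h.2.2⟩
  | enter G H hne =>
    obtain ⟨hF, hGH, hS⟩ := h
    -- The subsets left out of D are those of the previous G, treated in earlier passes.
    refine ⟨hF, subset_rfl, fun S hSD => ?_, fun S hSH hSD => hS S ?_⟩
    · exact Finset.mem_powerset.1 (Finset.mem_sdiff.1 hSD).1
    · by_contra hSG
      exact hSD (Finset.mem_sdiff.2
        ⟨Finset.mem_powerset.2 hSH, fun h => hSG (Finset.mem_powerset.1 h)⟩)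
  | subsetsEnd G H =>
    obtain ⟨hF, hGH, -, hS⟩ := h
    exact ⟨hF, hGH, fun S hSG => hS S hSG (Finset.notMem_empty S)⟩
  | skip G H D S hSD hX =>
    obtain ⟨hF, hGH, hD, hS⟩ := h
    refine ⟨hF, hGH, fun T hT => hD T (Finset.mem_of_mem_erase hT), fun T hTG hT => ?_⟩
    by_cases he : T = S
    · subst he
      exact fun X hX' => absurd ⟨X, hX'⟩ hX
    · exact hS T hTG fun hTD => hT (Finset.mem_erase.2 ⟨he, hTD⟩)
  | compute G H D S X B hSD hX hB =>
    obtain ⟨hF, hGH, hD, hS⟩ := h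
    refine ⟨hF, hGH, fun T hT => hD T (Finset.mem_of_mem_erase hT), fun T hTG hT he => ?_,
      hD S hSD, hX, B, hB, fun b hb => hb, fun b hb hb' => absurd hb hb'⟩
    exact hS T hTG fun hTD => hT (Finset.mem_erase.2 ⟨he, hTD⟩)
  | syzygiesEnd G H D S X =>
    obtain ⟨hF, hGH, hD, hS, hSH, hX, B₀, hB₀, -, hrep⟩ := h
    refine ⟨hF, hGH, hD, fun T hTG hT => ?_⟩
    by_cases he : T = S
    · subst he
      intro Y hY
      obtain rfl := isLcm_unique hX hY
      exact ⟨B₀, hB₀, fun b hb => hrep b hb (Finset.notMem_empty b)⟩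
    · exact hS T hTG hT he
  | form G H D S X B b hb =>
    obtain ⟨hF, hGH, hD, hS, hSH, hX, B₀, hB₀, hBB₀, hrep⟩ := h
    refine ⟨hF, hGH, hD, hS, hSH, hX, B₀, hB₀, fun b' hb' => hBB₀ b' (Finset.mem_of_mem_erase hb'),
      b, fun b' hb' hb'' hne => ?_, ?_, fun Y hY => lt_of_coeffAt_sVector_ne_zero hX ?_ hY⟩
    · exact hrep b' hb' fun h => hb'' (Finset.mem_erase.2 ⟨hne, h⟩)
    · rw [sub_self]
      exact zero_mem _
    · exact hB₀ ▸ Submodule.subset_span (hBB₀ b hb)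
  | red G H D S X B h k hr hk =>
    obtain ⟨hF, hGH, hD, hS, hSH, hX, B₀, hB₀, hBB₀, b₀, hrep, hsub, hlt⟩ := h
    refine ⟨hF, hGH, hD, hS, hSH, hX, B₀, hB₀, hBB₀, b₀, hrep, ?_, fun Y hY => ?_⟩
    · rw [← sub_add_sub_cancel _ h k]
      exact add_mem hsub (hk.sub_mem_rep hlt)
    · obtain ⟨Z, hZ⟩ := hk.lm_ne_bot
      exact W.lt_of_le_of_lt (hk.lt_lm hZ hY).1 (hlt Z (W.coeffAt_lm_ne_zero hZ))
  | discard G H D S X B =>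
    obtain ⟨hF, hGH, hD, hS, hSH, hX, B₀, hB₀, hBB₀, b₀, hrep, hsub, hlt⟩ := h
    refine ⟨hF, hGH, hD, hS, hSH, hX, B₀, hB₀, hBB₀, fun b hb hbB => ?_⟩
    by_cases he : b = b₀
    · subst he
      simpa using hsub
    · exact hrep b hb hbB he
  | adjoin G H D S X B h hr h0 =>
    obtain ⟨hF, hGH, hD, hS, hSH, hX, B₀, hB₀, hBB₀, b₀, hrep, hsub, hlt⟩ := h
    have hins : H ⊆ insert h H := Finset.subset_insert _ _
    -- Once adjoined, the remainder represents itself by the single term h · 1, whose leading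
    -- monomial is below X_S.
    have hmem : h ∈ W.rep (insert h H) {Y | W.lt Y X} := by
      have := smul_mem_rep (W := W) (H := insert h H) (g := h) (p := P.ι 1 * mon P.x 0)
        (U := {Y | W.lt Y X}) (Finset.mem_insert_self _ _) fun Y hY ν hν => by
          rw [P.eq_of_coeff_term_ne_zero hν, add_zero]
          exact hlt Y (W.coeffAt_lm_ne_zero hY)
      simpa [mon_zero] using this
    have hspan : h ∈ Submodule.span Aᵐᵒᵖ (F : Set (Fin m → A)) := by
      rw [← hF.span_eq]
      rw [← sub_sub_cancel (W.sVector S X b₀) h]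
      exact sub_mem (sVector_mem_span hSH X b₀) (mem_span_of_mem_rep hsub)
    refine ⟨⟨hF.subset.trans hins, ?_, ?_⟩, hGH.trans hins, fun T hT => (hD T hT).trans hins,
      fun T hTG hT he => (hS T hTG hT he).mono hins, hSH.trans hins, hX, B₀, hB₀, hBB₀,
      fun b hb hbB => ?_⟩
    · intro g hg
      rcases Finset.mem_insert.1 hg with rfl | hg
      · exact h0
      · exact hF.ne_zero g hg
    · intro g hg
      rcases Finset.mem_insert.1 hg with rfl | hg
      · exact hspan
      · exact hF.mem_span g hg
    · by_cases he : b = b₀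
      · subst he
        rw [← sub_add_cancel (W.sVector S X b) h]
        exact add_mem (rep_mono hins subset_rfl hsub) hmem
      · exact rep_mono hins subset_rfl (hrep b hb hbB he)

theorem invariant_test {F : Finset (Fin m → A)} (hF : ∀ f ∈ F, f ≠ 0) :
    Invariant W F (.test ∅ F) := by
  refine ⟨⟨subset_rfl, hF, fun g hg => Submodule.subset_span hg⟩, Finset.empty_subset F, ?_⟩
  intro S hS X hX
  rw [Finset.subset_empty.1 hS] at hX
  exact absurd hX.1 Finset.not_nonempty_empty

theorem invariant_of_reflTransGen [Nontrivial R] {F : Finset (Fin m → A)} (hF : ∀ f ∈ F, f ≠ 0)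
    {s : Config R A n m} (hs : Relation.ReflTransGen (Step W) (.test ∅ F) s) :
    Invariant W F s := by
  induction hs with
  | refl => exact invariant_test hF
  | tail _ hs ih => exact ih.step hs

theorem isGroebnerBasis_of_invariant [Nontrivial R] {F G : Finset (Fin m → A)}
    (hF : F.Nonempty) (h : Invariant W F (.done G)) :
    W.IsGroebnerBasis (Submodule.span Aᵐᵒᵖ (F : Set (Fin m → A))) G := by
  obtain ⟨hG, hsyz⟩ := h
  obtain ⟨f, hf⟩ := hF
  refine .inl ⟨fun hbot => ?_, ⟨f, hG.subset hf⟩,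
    fun g hg => ⟨hG.ne_zero g hg, hG.mem_span g hg⟩, ?_⟩
  · exact hG.ne_zero f (hG.subset hf)
      ((Submodule.mem_bot Aᵐᵒᵖ).1 (hbot ▸ Submodule.subset_span hf))
  · rintro k hk hk0 (h | h)
    · exact hk0 h
    · exact h (exists_red_of_mem_span hG.ne_zero hsyz (hG.span_eq ▸ hk) hk0)

end Correctness

end Algorithm

end SkewPBW

theorem mainTheorem4 {R A : Type*} [Ring R] [Ring A] [IsNoetherian Rᵐᵒᵖ R] {n m : ℕ}
    (P : SkewPBW.BijSkewPBWExt R A n) (O : SkewPBW.MonOrder P) (W : SkewPBW.VecMonOrder P O m)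
    (F : Finset (Fin m → A)) (hF : F.Nonempty) (hF0 : ∀ f ∈ F, f ≠ 0) :
    -- every execution is finite
    (¬ ∃ s : ℕ → SkewPBW.Config R A n m,
      s 0 = .test ∅ F ∧ ∀ k, SkewPBW.Step W (s k) (s (k + 1))) ∧
    -- an execution can only come to a halt by giving an output
    (∀ s, Relation.ReflTransGen (SkewPBW.Step W) (.test ∅ F) s →
      (∃ s', SkewPBW.Step W s s') ∨ ∃ G, s = .done G) ∧
    -- every output is a Groebner basis of the right submodule generated by `F`
    (∀ G, Relation.ReflTransGen (SkewPBW.Step W) (.test ∅ F) (.done G) →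
      W.IsGroebnerBasis (Submodule.span Aᵐᵒᵖ (F : Set (Fin m → A))) G) := by
  -- A nonzero vector has a nonzero coefficient, so the nonempty input excludes the zero ring.
  have hR : Nontrivial R := by
    obtain ⟨f, hf⟩ := hF
    obtain ⟨X, hX⟩ := W.exists_lm_eq (hF0 f hf)
    exact nontrivial_of_ne _ _ (W.coeffAt_lm_ne_zero hX)
  refine ⟨fun ⟨s, hs0, hs⟩ => ?_, fun s _ => SkewPBW.exists_step_or_eq_done s, fun G hG => ?_⟩
  · exact (acc_iff_isEmpty_descending_chain.1 ((SkewPBW.acc_step (W := W) F).1 ∅)).false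
      ⟨s, hs0, hs⟩
  · exact SkewPBW.isGroebnerBasis_of_invariant hF (SkewPBW.invariant_of_reflTransGen hF0 hG)
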